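/- **Models.** Write $w_i=(a_i,b_i,c_i)$, $i=1,2,3$, for three triples of six-vertex weights. A crossing of two oriented lines has weight $a_i$ if both lines are empty or both are occupied by a path, $b_i$ if a single path passes straight through, and $c_i$ if a single path turns from one line onto the other; paths are conserved at the crossing. *20V$_3$ model.* Let $\mathcal T_m$ ($m\ge 1$) be the triangle of vertices $(x,y)\in\mathbb Z^2$ with $1-m\le x\le 0$ and $-x\le y\le m-1$, together with all (internal and external) horizontal, vertical and diagonal edges (direction $(1,-1)$) incident to these vertices. A configuration is a choice of orientation of the edges with three incoming and three outgoing edges at each vertex, such that the external edges on the North boundary (vertical and diagonal) point out, the external edges on the East boundary (horizontal and diagonal) point in, and the external horizontal and vertical edges along the diagonal boundary $x+y=0$ point in on the top half and out on the bottom half; if $m$ is odd, the external horizontal edge of the central vertex of the diagonal boundary points in and its external vertical edge points out. Edges oriented along $(1,0)$, $(1,-1)$ or $(0,-1)$ are called occupied; they form a family of osculating paths. The weight of a configuration is the product over vertices of local weights. The local weight of a vertex is obtained by moving the diagonal line slightly up, which replaces the vertex by three crossings (horizontal–vertical, horizontal–diagonal, diagonal–vertical, with weights $w_1,w_2,w_3$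 respectively), and by summing the product of the three six-vertex weights over the states of the three inner edges compatible with the ice rule. For $1\le k\le m$, let $Z^{20V_3,\,\mathrm{horiz}}_{m,k}$ (resp. $Z^{20V_3,\,\mathrm{diag}}_{m,k}$) be the sum of the weights of the configurations for which the topmost vertex of the rightmost column visited by a path is the $k$-th one from the bottom and is reached by a horizontal (resp. diagonal) step. *6V$_1$ model.* For $1\le k\le n$, let $Z^{6V_1}_{n,k}$ be the sum of the weights, with vertex weights $w_1=(a_1,b_1,c_1)$, of the six-vertex configurations on the $n\times n$ grid with domain wall boundary conditions (horizontal external edges point in, vertical ones point out) for which the topmost vertex of the rightmost column visited by a path is the $k$-th one from the bottom. **Weights.** Let $\eta,\lambda,\mu$ be real with $$0<\eta<\lambda,\quad \eta-\lambda<\mu<\lambda-\eta,\quad \lambda+\eta<\pi,\quad \eta<\tfrac{\pi}{2},$$ let $\beta_1,\beta_2,\beta_3>0$, and let $$\begin{aligned}a_1&=\beta_1\sin(\lambda+\eta),& b_1&=\beta_1\sin(\lambda-\eta),& c_1&=\beta_1\sin(2\eta),\\ a_2&=\beta_2\sin\tfrac{\lambda+3\eta-\mu}{2},& b_2&=\beta_2\sin\tfrac{\lambda-\eta-\mu}{2},&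 c_2&=\beta_2\sin(2\eta),\\ a_3&=\beta_3\sin\tfrac{\lambda+3\eta+\mu}{2},& b_3&=\beta_3\sin\tfrac{\lambda-\eta+\mu}{2},& c_3&=\beta_3\sin(2\eta).\end{aligned}$$ **Theorem.** Let $\xi\in\mathbb C$ be such that $\sin(\xi+\lambda+\eta)$, $\sin(\xi+\lambda-\eta)$ and $\sin(\xi+\frac{\lambda+3\eta+\mu}{2})$ are nonzero, and set $$\tau=\frac{\sin(\xi+\lambda-\eta)\,\sin(\lambda+\eta)\,\sin(\xi+\frac{\lambda-\eta+\mu}{2})\,\sin(\frac{\lambda+3\eta+\mu}{2})}{\sin(\xi+\lambda+\eta)\,\sin(\lambda-\eta)\,\sin(\xi+\frac{\lambda+3\eta+\mu}{2})\,\sin(\frac{\lambda-\eta+\mu}{2})},$$ $$\gamma=\frac{\sin(\lambda-\eta)\,\sin(\xi+\frac{\lambda+3\eta+\mu}{2})}{\sin(\xi+\lambda-\eta)\,\sin(\frac{\lambda+3\eta+\mu}{2})},\qquad \sigma=\frac{\sin(\xi+\lambda-\eta)\,\sin(\lambda+\eta)}{\sin(\xi+\lambda+\eta)\,\sin(\lambda-\eta)}.$$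 Then for every $n\ge 1$, $$\sum_{k=1}^{2n}\left(Z^{20V_3,\,\mathrm{diag}}_{2n,k}+\gamma\,Z^{20V_3,\,\mathrm{horiz}}_{2n,k}\right)\tau^{k-1}=(a_2a_3)^{n(2n+1)}\,b_1^{n(n+1)}\,\gamma\,\sigma^{n}\sum_{k=1}^n Z^{6V_1}_{n,k}\,\sigma^{k-1},$$ $$\sum_{k=1}^{2n-1}\left(Z^{20V_3,\,\mathrm{diag}}_{2n-1,k}+\gamma\,Z^{20V_3,\,\mathrm{horiz}}_{2n-1,k}\right)\tau^{k-1}=(a_2a_3)^{n(2n-1)}\,b_1^{n(n-1)}\,\gamma\,\sigma^{n-1}\sum_{k=1}^n Z^{6V_1}_{n,k}\,\sigma^{k-1}.$$ -/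

import Mathlib

namespace TwentyVertex

open Finset

/-! Vertices are pairs `(r, c)`: `r` is the row, counted from the top starting at `0`, and `c` is
the column, counted from the right starting at `0`. Configurations are written in the
osculating-path language: an edge is occupied if it is oriented rightward (horizontal),
downward (vertical) or down-rightward (diagonal), and unoccupied if it has the
opposite orientation. A configuration is given by its sets of occupied edges. -/

section SixVertex

/-- The three Boltzmann weights of a six-vertex model. -/
structure SixWeights where
  a : ℝ
  b : ℝ
  c : ℝ

/-- Weight of the crossing of two lines. The first line enters with occupation `i₁` and leaves with
`o₁`, the second one enters with `i₂` and leaves with `o₂`. The ice rule is `i₁ + i₂ = o₁ + o₂`;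
the weight is `a` if both lines are empty or both are occupied, `b` if a single path goes
straight, `c` if a single path changes line. -/
def SixWeights.weight (w : SixWeights) (i₁ i₂ o₁ o₂ : Bool) : ℝ :=
  if i₁.toNat + i₂.toNat = o₁.toNat + o₂.toNat then
    if i₁ = i₂ then w.a else if i₁ = o₁ then w.b else w.c
  else 0

/-- A configuration of the square lattice: occupied horizontal and vertical edges.
At the vertex `(r, c)` the left edge is the horizontal edge `(r, c + 1)`, the right edge is
the horizontal edge `(r, c)`, the top edge is the vertical edge `(r, c)` and the bottom edge is
the vertical edge `(r + 1, c)`. -/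
abbrev SqConfig := Finset (ℕ × ℕ) × Finset (ℕ × ℕ)

def SqConfig.hor (C : SqConfig) (r c : ℕ) : Bool := decide ((r, c) ∈ C.1)
def SqConfig.ver (C : SqConfig) (r c : ℕ) : Bool := decide ((r, c) ∈ C.2)

/-- Domain wall boundary conditions on the `n × n` grid: all horizontal external edges point into
the square, all vertical external edges point out. -/
def SqConfig.IsDWBC (n : ℕ) (C : SqConfig) : Prop :=
  (∀ r < n, C.hor r n = true ∧ C.hor r 0 = false) ∧
  (∀ c < n, C.ver 0 c = false ∧ C.ver n c = true)

/-- Ice rule at every vertex of the grid. -/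
def SqConfig.IsIce (n : ℕ) (C : SqConfig) : Prop :=
  ∀ r < n, ∀ c < n, (C.hor r (c + 1)).toNat + (C.ver r c).toNat
    = (C.hor r c).toNat + (C.ver (r + 1) c).toNat

open Classical in
/-- The configurations of the six-vertex model with DWBC on the `n × n` grid. -/
noncomputable def sixConfigs (n : ℕ) : Finset SqConfig :=
  ((range n ×ˢ range (n + 1)).powerset ×ˢ (range (n + 1) ×ˢ range n).powerset).filter
    fun C => C.IsDWBC n ∧ C.IsIce n

/-- Product of the local vertex weights. -/
def SqConfig.totalWeight (n : ℕ) (w : SixWeights) (C : SqConfig) : ℝ :=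
  ∏ v ∈ range n ×ˢ range n,
    w.weight (C.hor v.1 (v.2 + 1)) (C.ver v.1 v.2) (C.hor v.1 v.2) (C.ver (v.1 + 1) v.2)

/-- The vertex `(r, c)` is visited by a path. -/
def SqConfig.Visited (C : SqConfig) (r c : ℕ) : Prop :=
  C.hor r (c + 1) = true ∨ C.hor r c = true ∨ C.ver r c = true ∨ C.ver (r + 1) c = true

/-- The topmost vertex of the rightmost column visited by a path is the `k`-th one counted from
bottom to top (starting at `1`). -/
def SqConfig.TopAt (n k : ℕ) (C : SqConfig) : Prop :=
  C.Visited (n - k) 0 ∧ ∀ r < n - k, ¬ C.Visited r 0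

open Classical in
/-- The refined DWBC partition function `Z_{n,k}` of the six-vertex model, `1 ≤ k ≤ n`. -/
noncomputable def Z6 (w : SixWeights) (n k : ℕ) : ℝ :=
  ∑ C ∈ (sixConfigs n).filter (fun C => C.TopAt n k), C.totalWeight n w

end SixVertex

section TwentyVertexModel

/-- A configuration of the triangular lattice: occupied horizontal, diagonal and vertical edges.
Horizontal and vertical edges are labelled as for the square lattice. At the vertex `(r, c)` the
upper left diagonal edge is the diagonal edge `(r, c + 1)` and the lower right one is the
diagonal edge `(r + 1, c)`. -/
abbrev TriConfig := Finset (ℕ × ℕ) × Finset (ℕ × ℕ) × Finset (ℕ × ℕ)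

def TriConfig.hor (C : TriConfig) (r c : ℕ) : Bool := decide ((r, c) ∈ C.1)
def TriConfig.diag (C : TriConfig) (r c : ℕ) : Bool := decide ((r, c) ∈ C.2.1)
def TriConfig.ver (C : TriConfig) (r c : ℕ) : Bool := decide ((r, c) ∈ C.2.2)

/-- The vertices of the triangle of size `m`: row `r` has `m - r` vertices, and the right angle
is at the top right corner `(0, 0)`. -/
def triVertices (m : ℕ) : Finset (ℕ × ℕ) :=
  (range m ×ˢ range m).filter fun v => v.1 + v.2 < m

/-- The edges (internal and external) of the triangle, of the three types. -/
def triHorEdges (m : ℕ) : Finset (ℕ × ℕ) :=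
  (range m ×ˢ range (m + 1)).filter fun e => e.1 + e.2 ≤ m
def triDiagEdges (m : ℕ) : Finset (ℕ × ℕ) :=
  (range (m + 1) ×ˢ range (m + 1)).filter fun e => 1 ≤ e.1 + e.2 ∧ e.1 + e.2 ≤ m
def triVerEdges (m : ℕ) : Finset (ℕ × ℕ) :=
  (range (m + 1) ×ˢ range m).filter fun e => e.1 + e.2 ≤ m

/-- The boundary conditions DWBC3 on the triangle of size `m`.
North: vertical and diagonal external edges point out. East: horizontal and diagonal external
edges point in. Diagonal boundary, formed by the vertices `(r, m - 1 - r)`: the external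
(left and bottom) edges point in on the top half and out on the bottom half; for odd `m` the left
external edge of the central vertex points in and its bottom external edge points out. -/
def TriConfig.IsDWBC3 (m : ℕ) (C : TriConfig) : Prop :=
  (∀ c < m, C.ver 0 c = false ∧ C.diag 0 (c + 1) = false) ∧
  (∀ r < m, C.hor r 0 = false ∧ C.diag (r + 1) 0 = false) ∧
  (∀ r < m, (C.hor r (m - r) = true ↔ r < (m + 1) / 2) ∧
    (C.ver (r + 1) (m - 1 - r) = true ↔ m / 2 ≤ r))

/-- Ice rule at every vertex: equally many occupied edges among the left, upper left, top ones as
among the right, lower right, bottom ones, i.e. three incoming and three outgoing edges. -/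
def TriConfig.IsIce (m : ℕ) (C : TriConfig) : Prop :=
  ∀ v ∈ triVertices m,
    (C.hor v.1 (v.2 + 1)).toNat + (C.diag v.1 (v.2 + 1)).toNat + (C.ver v.1 v.2).toNat
      = (C.hor v.1 v.2).toNat + (C.diag (v.1 + 1) v.2).toNat + (C.ver (v.1 + 1) v.2).toNat

open Classical in
/-- The configurations of the 20V₃ model on the triangle of size `m`. -/
noncomputable def triConfigs (m : ℕ) : Finset TriConfig :=
  ((triHorEdges m).powerset ×ˢ (triDiagEdges m).powerset ×ˢ (triVerEdges m).powerset).filter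
    fun C => C.IsDWBC3 m ∧ C.IsIce m

/-- The weight of a vertex of the twenty-vertex model, given the occupations of its left (`W`),
upper left (`NW`), top (`N`), right (`E`), lower right (`SE`) and bottom (`S`) edges. The diagonal
line is moved slightly up, so that it meets first the vertical line above the crossing of the
horizontal and vertical lines and then the horizontal line to the right of this crossing;
one sums the product of the three six-vertex weights over the states of the three inner edges.
`w₁`, `w₂`, `w₃` are the weights of the horizontal-vertical, horizontal-diagonal and
diagonal-vertical crossings. -/
def vertexWeight (w₁ w₂ w₃ : SixWeights) (W NW N E SE S : Bool) : ℝ :=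
  ∑ x : Bool, ∑ y : Bool, ∑ u : Bool,
    w₃.weight NW N x y * w₁.weight W y u S * w₂.weight u x E SE

/-- Product of the local vertex weights. -/
def TriConfig.totalWeight (m : ℕ) (w₁ w₂ w₃ : SixWeights) (C : TriConfig) : ℝ :=
  ∏ v ∈ triVertices m,
    vertexWeight w₁ w₂ w₃
      (C.hor v.1 (v.2 + 1)) (C.diag v.1 (v.2 + 1)) (C.ver v.1 v.2)
      (C.hor v.1 v.2) (C.diag (v.1 + 1) v.2) (C.ver (v.1 + 1) v.2)

/-- The vertex `(r, c)` is visited by a path. -/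
def TriConfig.Visited (C : TriConfig) (r c : ℕ) : Prop :=
  C.hor r (c + 1) = true ∨ C.diag r (c + 1) = true ∨ C.ver r c = true ∨
  C.hor r c = true ∨ C.diag (r + 1) c = true ∨ C.ver (r + 1) c = true

/-- The topmost vertex of the rightmost column visited by a path is the `k`-th one counted from
bottom to top (starting at `1`). -/
def TriConfig.TopAt (m k : ℕ) (C : TriConfig) : Prop :=
  C.Visited (m - k) 0 ∧ ∀ r < m - k, ¬ C.Visited r 0

open Classical in
/-- The contribution to the partition function of the 20V₃ model of the configurations that reach
the rightmost column at position `k` with a horizontal step. -/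
noncomputable def Z20Horiz (w₁ w₂ w₃ : SixWeights) (m k : ℕ) : ℝ :=
  ∑ C ∈ (triConfigs m).filter (fun C => C.TopAt m k ∧ C.hor (m - k) 1 = true),
    C.totalWeight m w₁ w₂ w₃

open Classical in
/-- The contribution to the partition function of the 20V₃ model of the configurations that reach
the rightmost column at position `k` with a diagonal step. -/
noncomputable def Z20Diag (w₁ w₂ w₃ : SixWeights) (m k : ℕ) : ℝ :=
  ∑ C ∈ (triConfigs m).filter (fun C => C.TopAt m k ∧ C.diag (m - k) 1 = true),
    C.totalWeight m w₁ w₂ w₃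

end TwentyVertexModel

section IntegrableWeights

/-- Weights of the horizontal-vertical crossings. -/
noncomputable def weights₁ (β η lam : ℝ) : SixWeights where
  a := β * Real.sin (lam + η)
  b := β * Real.sin (lam - η)
  c := β * Real.sin (2 * η)

/-- Weights of the horizontal-diagonal crossings. -/
noncomputable def weights₂ (β η lam μ : ℝ) : SixWeights where
  a := β * Real.sin ((lam + 3 * η - μ) / 2)
  b := β * Real.sin ((lam - η - μ) / 2)
  c := β * Real.sin (2 * η)

/-- Weights of the diagonal-vertical crossings. -/
noncomputable def weights₃ (β η lam μ : ℝ) : SixWeights where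
  a := β * Real.sin ((lam + 3 * η + μ) / 2)
  b := β * Real.sin ((lam - η + μ) / 2)
  c := β * Real.sin (2 * η)

noncomputable def tau (η lam μ ξ : ℂ) : ℂ :=
  (Complex.sin (ξ + lam - η) * Complex.sin (lam + η) *
    Complex.sin (ξ + (lam - η + μ) / 2) * Complex.sin ((lam + 3 * η + μ) / 2)) /
  (Complex.sin (ξ + lam + η) * Complex.sin (lam - η) *
    Complex.sin (ξ + (lam + 3 * η + μ) / 2) * Complex.sin ((lam - η + μ) / 2))

noncomputable def gam (η lam μ ξ : ℂ) : ℂ :=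
  (Complex.sin (lam - η) * Complex.sin (ξ + (lam + 3 * η + μ) / 2)) /
  (Complex.sin (ξ + lam - η) * Complex.sin ((lam + 3 * η + μ) / 2))

noncomputable def sig (η lam ξ : ℂ) : ℂ :=
  (Complex.sin (ξ + lam - η) * Complex.sin (lam + η)) /
  (Complex.sin (ξ + lam + η) * Complex.sin (lam - η))

end IntegrableWeights

/-- The refined partition function `∑ₖ (Z^diag_{m,k} + γ Z^horiz_{m,k}) τ^(k-1)`. -/
noncomputable def refined20 (w₁ w₂ w₃ : SixWeights) (m : ℕ) (γ τ : ℂ) : ℂ :=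
  ∑ k ∈ Icc 1 m, (((Z20Diag w₁ w₂ w₃ m k : ℝ) : ℂ) + γ * ((Z20Horiz w₁ w₂ w₃ m k : ℝ) : ℂ))
    * τ ^ (k - 1)

/-- The refined partition function `∑ₖ Z_{n,k} σ^(k-1)` of the six-vertex model. -/
noncomputable def refined6 (w : SixWeights) (n : ℕ) (σ : ℂ) : ℂ :=
  ∑ k ∈ Icc 1 n, ((Z6 w n k : ℝ) : ℂ) * σ ^ (k - 1)

end TwentyVertex

namespace TwentyVertex

open Finset

/-! The proof removes the diagonal lines by Yang–Baxter moves, with a shifted spectral parameter on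
the rightmost vertical line that produces the refinement.

Each twenty-vertex vertex is a triple of six-vertex crossings, and the given weights satisfy the
star-triangle relations (`isYB_trigWeights`). A diagonal line can therefore be pushed through a
layer `r + c = const` of horizontal–vertical crossings, towards the corner `(0, 0)`. Both its ends
are empty, so each push costs only two `a` weights, one with the vertical line and one with the
horizontal line left behind (`layer_exchange`). Pushing every diagonal line out turns the triangle
into a pure six-vertex model times an explicit product (`layerPartition_local20`). There the
diagonal boundary condition freezes everything outside an `n × n` square, `n` being half of `m`
rounded up: each outer vertex has weight `b`, and the square carries domain wall boundary conditions
(`frozen_region`, `sum_triConfigs_local6`).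

The argument allows column-dependent weights, since star-triangle is needed for each column
separately, with `w₂` common. Shifting the spectral parameter of column `0` by `ξ` changes `w₁` and
`w₃` there, but not `w₂` nor the `c` weights. Let `p, q, h, t` be the resulting ratios of `a₁, b₁,
a₃, b₃`. Exactly one path enters column `0`, at some row `r₀`: the vertices above it are empty,
those below are crossed vertically, and the entrance is horizontal or diagonal. The weight of the
configuration is thus multiplied by `(p h)^r₀ (q t)^(m-1-r₀)` times `h` (horizontal) or `q`
(diagonal). This is the refined sum with `γ = h / q` and `τ = q t / (p h)`, and on the square the
same modification gives `σ = q / p`. The removed diagonals contribute `h ^ m` and the frozen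
vertices of column `0` contribute `q ^ (m / 2)`; comparing powers gives the formula
(`refined20_eq`). -/

/-- Complex six-vertex weights. -/
structure CWeights where
  a : ℂ
  b : ℂ
  c : ℂ

/-- Weight of the crossing of two lines, with the conventions of `SixWeights.weight`. -/
def CWeights.weight (w : CWeights) (i₁ i₂ o₁ o₂ : Bool) : ℂ :=
  if i₁.toNat + i₂.toNat = o₁.toNat + o₂.toNat then
    if i₁ = i₂ then w.a else if i₁ = o₁ then w.b else w.c
  else 0

/-- The complex weights with the same values as real ones. -/
def SixWeights.toC (w : SixWeights) : CWeights := ⟨w.a, w.b, w.c⟩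

theorem SixWeights.coe_weight (w : SixWeights) (i₁ i₂ o₁ o₂ : Bool) :
    ((w.weight i₁ i₂ o₁ o₂ : ℝ) : ℂ) = w.toC.weight i₁ i₂ o₁ o₂ := by
  unfold SixWeights.weight CWeights.weight SixWeights.toC
  split_ifs <;> simp

/-- Complex version of `vertexWeight`. -/
def cVertexWeight (w₁ w₂ w₃ : CWeights) (W NW N E SE S : Bool) : ℂ :=
  ∑ x : Bool, ∑ y : Bool, ∑ u : Bool,
    w₃.weight NW N x y * w₁.weight W y u S * w₂.weight u x E SE

theorem coe_vertexWeight (w₁ w₂ w₃ : SixWeights) (W NW N E SE S : Bool) :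
    ((vertexWeight w₁ w₂ w₃ W NW N E SE S : ℝ) : ℂ) =
      cVertexWeight w₁.toC w₂.toC w₃.toC W NW N E SE S := by
  simp [vertexWeight, cVertexWeight, SixWeights.coe_weight]

theorem CWeights.weight_table (w : CWeights) :
    w.weight false false false false = w.a ∧ w.weight true true true true = w.a ∧
    w.weight true false true false = w.b ∧ w.weight false true false true = w.b ∧
    w.weight true false false true = w.c ∧ w.weight false true true false = w.c ∧
    w.weight false false true false = 0 ∧ w.weight false false false true = 0 ∧
    w.weight false false true true = 0 ∧ w.weight true false false false = 0 ∧
    w.weight true false true true = 0 ∧ w.weight false true false false = 0 ∧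
    w.weight false true true true = 0 ∧ w.weight true true false false = 0 ∧
    w.weight true true true false = 0 ∧ w.weight true true false true = 0 := by
  simp [CWeights.weight]

/-! ### Star-triangle relations -/

/-- The star-triangle relations. -/
structure IsYB (w₁ w₂ w₃ : CWeights) : Prop where
  bbc : w₂.a * w₁.b * w₃.c = w₃.c * w₁.a * w₂.b + w₃.b * w₁.c * w₂.c
  aca : w₂.a * w₁.c * w₃.a = w₁.c * w₃.b * w₂.b + w₃.c * w₁.a * w₂.c
  cba : w₂.c * w₁.b * w₃.a = w₂.c * w₃.b * w₁.a + w₃.c * w₁.c * w₂.b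

/-- The diagonal line passes below the horizontal–vertical crossing on the left side and above it on
the right side. Over the 64 boundary states, either both sides agree identically or the equality is,
up to sign, one of the three relations. -/
theorem IsYB.exchange {w₁ w₂ w₃ : CWeights} (h : IsYB w₁ w₂ w₃) (u x N E x' y : Bool) :
    ∑ l : Bool, ∑ d : Bool, ∑ b : Bool,
      w₂.weight u x l d * w₁.weight l N E b * w₃.weight d b x' y =
    cVertexWeight w₁ w₂ w₃ u x N E x' y := by
  cases u <;> cases x <;> cases N <;> cases E <;> cases x' <;> cases y <;>
    simp only [cVertexWeight, Fintype.sum_bool, CWeights.weight_table, mul_zero, zero_mul,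
      add_zero, zero_add] <;>
    first
      | linear_combination h.bbc
      | linear_combination h.aca
      | linear_combination h.cba
      | linear_combination -h.bbc
      | linear_combination -h.aca
      | linear_combination -h.cba
      | ring

/-- Trigonometric six-vertex weights with spectral parameter `u` and crossing parameter `η`. -/
noncomputable def trigWeights (β η u : ℂ) : CWeights :=
  ⟨β * Complex.sin (u + η), β * Complex.sin (u - η), β * Complex.sin (2 * η)⟩

/-- The parameter `p + q - η` makes the `a` and `b` weights of the first crossing `sin (p + q)` and
`sin (p + q - 2η)`. Every relation then has the factor `sin (2η)`, and what remains is an identity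
between products of two sines. The freedom in `q` at fixed `p` is what later allows the shift of a
single vertical line. -/
theorem isYB_trigWeights (β₁ β₂ β₃ η p q : ℂ) :
    IsYB (trigWeights β₁ η (p + q - η)) (trigWeights β₂ η p) (trigWeights β₃ η q) := by
  have h1 : p + q - η + η = p + q := by ring
  have h2 : p + q - η - η = p + q - (η + η) := by ring
  have hη := Complex.sin_sq_add_cos_sq η
  have hp := Complex.sin_sq_add_cos_sq p
  have hq := Complex.sin_sq_add_cos_sq q
  have key1 : Complex.sin (p + η) * Complex.sin (p + q - (η + η)) =
      Complex.sin (p + q) * Complex.sin (p - η) + Complex.sin (q - η) * Complex.sin (η + η) := by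
    simp only [Complex.sin_add, Complex.sin_sub, Complex.cos_add]
    generalize Complex.sin p = sp at *
    generalize Complex.cos p = cp at *
    generalize Complex.sin q = sq at *
    generalize Complex.cos q = cq at *
    generalize Complex.sin η = s at *
    generalize Complex.cos η = c at *
    grind
  have key2 : Complex.sin (p + η) * Complex.sin (q + η) =
      Complex.sin (q - η) * Complex.sin (p - η) + Complex.sin (p + q) * Complex.sin (η + η) := by
    simp only [Complex.sin_add, Complex.sin_sub]
    ring
  have key3 : Complex.sin (p + q - (η + η)) * Complex.sin (q + η) =
      Complex.sin (q - η) * Complex.sin (p + q) + Complex.sin (η + η) * Complex.sin (p - η) := by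
    simp only [Complex.sin_add, Complex.sin_sub, Complex.cos_add]
    generalize Complex.sin p = sp at *
    generalize Complex.cos p = cp at *
    generalize Complex.sin q = sq at *
    generalize Complex.cos q = cq at *
    generalize Complex.sin η = s at *
    generalize Complex.cos η = c at *
    grind
  constructor <;> simp only [trigWeights, h1, h2, two_mul]
  · linear_combination β₁ * β₂ * β₃ * Complex.sin (η + η) * key1
  · linear_combination β₁ * β₂ * β₃ * Complex.sin (η + η) * key2
  · linear_combination β₁ * β₂ * β₃ * Complex.sin (η + η) * key3

/-! ### Sums over edge sets as transfer-matrix products -/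

/-- Indicator of a finite set, with values in `Bool`. -/
def ind (S : Finset ℕ) (r : ℕ) : Bool := decide (r ∈ S)

theorem ind_eq_false {S : Finset ℕ} {r : ℕ} (h : r ∉ S) : ind S r = false := by simp [ind, h]

theorem ind_insert (S : Finset ℕ) (k : ℕ) : ind (insert k S) = Function.update (ind S) k true := by
  ext r
  by_cases h : r = k <;> simp [ind, h]

theorem sum_powerset_insert_ind {k : ℕ} {S : Finset ℕ} (hk : k ∉ S) (f : (ℕ → Bool) → ℂ) :
    ∑ A ∈ (insert k S).powerset, f (ind A) =
      ∑ A ∈ S.powerset, ∑ b : Bool, f (Function.update (ind A) k b) := by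
  rw [sum_powerset_insert hk, ← sum_add_distrib]
  refine sum_congr rfl fun A hA => ?_
  have hkA : ind A k = false := ind_eq_false fun h => hk (mem_powerset.1 hA h)
  rw [Fintype.sum_bool, ind_insert, add_comm, ← hkA, Function.update_eq_self]

/-- Iterated product of transfer matrices acting on pairs of bits, started from `(0, 0)`. -/
def chain (T : ℕ → Bool → Bool → Bool → Bool → Bool → ℂ) : ℕ → Bool → Bool → ℂ
  | 0, d, b => if d = false ∧ b = false then 1 else 0
  | k + 1, d', b' => ∑ d : Bool, ∑ b : Bool, chain T k d b * ∑ l : Bool, T k d b l d' b'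

/-- The factors couple only neighbouring values of `r`: the bits of `D` and `B` are passed from one
step to the next, while the bit of `L` is internal to its step. The index `0` is excluded from `B`
and `D`, which gives the initial state `(0, 0)`; the function `g` closes the chain. -/
theorem sum_powerset_prod_eq_chain (T : ℕ → Bool → Bool → Bool → Bool → Bool → ℂ) (k : ℕ)
    (g : Bool → Bool → ℂ) :
    ∑ L ∈ (range k).powerset, ∑ B ∈ (Ico 1 (k + 1)).powerset, ∑ D ∈ (Ico 1 (k + 1)).powerset,
      (∏ r ∈ range k, T r (ind D r) (ind B r) (ind L r) (ind D (r + 1)) (ind B (r + 1))) *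
        g (ind D k) (ind B k) =
    ∑ d : Bool, ∑ b : Bool, chain T k d b * g d b := by
  induction k generalizing g with
  | zero => simp [chain, ind]
  | succ k ih =>
    have hI : Ico 1 (k + 1 + 1) = insert (k + 1) (Ico 1 (k + 1)) := by
      ext; grind
    have hk : k + 1 ∉ Ico 1 (k + 1) := by simp
    rw [range_add_one, hI]
    rw [sum_powerset_insert_ind notMem_range_self fun L =>
      ∑ B ∈ (insert (k + 1) (Ico 1 (k + 1))).powerset,
      ∑ D ∈ (insert (k + 1) (Ico 1 (k + 1))).powerset,
      (∏ r ∈ insert k (range k), T r (ind D r) (ind B r) (L r) (ind D (r + 1)) (ind B (r + 1))) *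
        g (ind D (k + 1)) (ind B (k + 1))]
    have h1 : ∀ L ∈ (range k).powerset, ∑ l : Bool,
        ∑ B ∈ (insert (k + 1) (Ico 1 (k + 1))).powerset,
        ∑ D ∈ (insert (k + 1) (Ico 1 (k + 1))).powerset,
        (∏ r ∈ insert k (range k), T r (ind D r) (ind B r) (Function.update (ind L) k l r)
          (ind D (r + 1)) (ind B (r + 1))) * g (ind D (k + 1)) (ind B (k + 1)) =
        ∑ B ∈ (Ico 1 (k + 1)).powerset, ∑ D ∈ (Ico 1 (k + 1)).powerset,
          (∏ r ∈ range k, T r (ind D r) (ind B r) (ind L r) (ind D (r + 1)) (ind B (r + 1))) *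
          ∑ d : Bool, ∑ b : Bool, (∑ l : Bool, T k (ind D k) (ind B k) l d b) * g d b := by
      intro L _
      rw [sum_comm]
      rw [sum_powerset_insert_ind hk fun B => ∑ l : Bool,
        ∑ D ∈ (insert (k + 1) (Ico 1 (k + 1))).powerset,
        (∏ r ∈ insert k (range k), T r (ind D r) (B r) (Function.update (ind L) k l r)
          (ind D (r + 1)) (B (r + 1))) * g (ind D (k + 1)) (B (k + 1))]
      refine sum_congr rfl fun B _ => ?_
      have h2 : ∀ b l, ∑ D ∈ (insert (k + 1) (Ico 1 (k + 1))).powerset,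
          (∏ r ∈ insert k (range k), T r (ind D r) (Function.update (ind B) (k + 1) b r)
            (Function.update (ind L) k l r)
          (ind D (r + 1)) (Function.update (ind B) (k + 1) b (r + 1))) *
            g (ind D (k + 1)) (Function.update (ind B) (k + 1) b (k + 1)) =
          ∑ D ∈ (Ico 1 (k + 1)).powerset,
          (∏ r ∈ range k, T r (ind D r) (ind B r) (ind L r) (ind D (r + 1)) (ind B (r + 1))) *
          ∑ d : Bool, T k (ind D k) (ind B k) l d b * g d b := by
        intro b l
        rw [sum_powerset_insert_ind hk fun D =>
          (∏ r ∈ insert k (range k), T r (D r) (Function.update (ind B) (k + 1) b r)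
            (Function.update (ind L) k l r)
          (D (r + 1)) (Function.update (ind B) (k + 1) b (r + 1))) *
            g (D (k + 1)) (Function.update (ind B) (k + 1) b (k + 1))]
        refine sum_congr rfl fun D _ => ?_
        rw [mul_sum]
        refine sum_congr rfl fun d _ => ?_
        rw [prod_insert notMem_range_self]
        have h3 : ∀ r ∈ range k, T r (Function.update (ind D) (k + 1) d r)
            (Function.update (ind B) (k + 1) b r) (Function.update (ind L) k l r)
            (Function.update (ind D) (k + 1) d (r + 1))
            (Function.update (ind B) (k + 1) b (r + 1)) =
            T r (ind D r) (ind B r) (ind L r) (ind D (r + 1)) (ind B (r + 1)) := by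
          intro r hr
          have hr := mem_range.1 hr
          rw [Function.update_of_ne (by omega), Function.update_of_ne (by omega),
            Function.update_of_ne (by omega), Function.update_of_ne (by omega),
            Function.update_of_ne (by omega)]
        rw [prod_congr rfl h3]
        simp only [Function.update_self]
        rw [Function.update_of_ne (by omega), Function.update_of_ne (by omega)]
        ring
      simp only [h2, Fintype.sum_bool, ← sum_add_distrib]
      refine sum_congr rfl fun D _ => ?_
      ring
    -- The last transfer step is absorbed into the closing function, which is why the induction is
    -- over all `g`.
    rw [sum_congr rfl h1, ih fun d' b' =>
      ∑ d : Bool, ∑ b : Bool, (∑ l : Bool, T k d' b' l d b) * g d b]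
    simp only [chain, Fintype.sum_bool]
    ring

/-! ### Layer-by-layer partition functions -/

/-- Local weights of a model on the triangular lattice, as functions of the position `(r, c)` and
of the states of the left, upper left, top, right, lower right and bottom edges. -/
abbrev LocalWeight := ℕ → ℕ → Bool → Bool → Bool → Bool → Bool → Bool → ℂ

/-- The weight of the layer of vertices `(r, m - r)`: `L'`, `B'` are the states of its
left and bottom edges, `L`, `B` those of its right and top edges, `δ`
those of its diagonal edges. -/
def layerWeight (ω : LocalWeight) (m : ℕ) (L' B' δ L B : ℕ → Bool) : ℂ :=
  ∏ r ∈ range (m + 1), ω r (m - r) (L' r) (δ r) (B r) (L r) (δ (r + 1)) (B' (r + 1))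

/-- The layer weight summed over the inner diagonal edges. -/
def layerSum (ω : LocalWeight) (m : ℕ) (L' B' L B : ℕ → Bool) : ℂ :=
  ∑ D ∈ (Ico 1 (m + 1)).powerset, layerWeight ω m L' B' (ind D) L B

/-- The partition function of the triangle of size `m` with given states of the edges along the
diagonal boundary, computed layer by layer. -/
def layerPartition (ω : LocalWeight) : ℕ → (ℕ → Bool) → (ℕ → Bool) → ℂ
  | 0, _, _ => 1
  | m + 1, L', B' => ∑ L ∈ (range m).powerset, ∑ B ∈ (Ico 1 (m + 1)).powerset,
      layerSum ω m L' B' (ind L) (ind B) * layerPartition ω m (ind L) (ind B)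

/-- Local weights of the twenty-vertex model, with column-dependent weights. -/
def local20 (w₁ : ℕ → CWeights) (w₂ : CWeights) (w₃ : ℕ → CWeights) : LocalWeight :=
  fun _ c => cVertexWeight (w₁ c) w₂ (w₃ c)

/-- Local weights of the six-vertex model, all diagonal edges being empty. -/
def local6 (w₁ : ℕ → CWeights) : LocalWeight :=
  fun _ c W NW N E SE S => if NW = false ∧ SE = false then (w₁ c).weight W N E S else 0

theorem layerSum_local6 (w₁ : ℕ → CWeights) (m : ℕ) (L' B' L B : ℕ → Bool) :
    layerSum (local6 w₁) m L' B' L B =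
      ∏ r ∈ range (m + 1), (w₁ (m - r)).weight (L' r) (B r) (L r) (B' (r + 1)) := by
  unfold layerSum
  rw [sum_eq_single ∅]
  · simp [layerWeight, local6, ind]
  · intro D hD hne
    obtain ⟨d, hd⟩ := nonempty_iff_ne_empty.2 hne
    have hd' := mem_Ico.1 (mem_powerset.1 hD hd)
    refine prod_eq_zero (i := d) (mem_range.2 hd'.2) ?_
    simp [local6, ind, hd]
  · simp

theorem sum_comm_pairs {α β γ δ : Type*} (s : Finset α) (t : Finset β) (u : Finset γ)
    (v : Finset δ) (f : α → β → γ → δ → ℂ) :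
    ∑ a ∈ s, ∑ b ∈ t, ∑ c ∈ u, ∑ d ∈ v, f a b c d =
      ∑ c ∈ u, ∑ d ∈ v, ∑ a ∈ s, ∑ b ∈ t, f a b c d := by
  have h := sum_comm (s := s ×ˢ t) (t := u ×ˢ v) (f := fun x y => f x.1 x.2 y.1 y.2)
  simpa only [sum_product] using h

/-! ### Pushing the diagonal lines out of the triangle -/

section

variable {w₁ : ℕ → CWeights} {w₂ : CWeights} {w₃ : ℕ → CWeights}

/-- The regrouping behind `chain_exchange`, for arbitrary crossing weights. The incoming crossing
`R` joins `A` and `S` to form a twenty-vertex weight, and `W` becomes the crossing handed on to the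
next step. -/
theorem sum_transfer_aux (P : Bool → Bool → ℂ) (R : Bool → Bool → Bool → Bool → ℂ)
    (A : Bool → Bool → ℂ) (S : Bool → Bool → Bool → Bool → ℂ) (M W : Bool → Bool → ℂ) :
    ∑ x : Bool, ∑ y : Bool, (∑ d : Bool, ∑ b : Bool, P d b * R d b x y) *
        ∑ u : Bool, A y u * ∑ l : Bool, ∑ d : Bool, ∑ b : Bool, S u x l d * M l b * W d b =
      ∑ d' : Bool, ∑ b' : Bool, (∑ d : Bool, ∑ b : Bool, P d b *
        ∑ l : Bool, (∑ x : Bool, ∑ y : Bool, ∑ u : Bool, R d b x y * A y u * S u x l d') *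
          M l b') * W d' b' := by
  have h (d' b') : (∑ d : Bool, ∑ b : Bool, P d b *
        ∑ l : Bool, (∑ x : Bool, ∑ y : Bool, ∑ u : Bool, R d b x y * A y u * S u x l d') *
          M l b') = ∑ x : Bool, ∑ y : Bool, (∑ d : Bool, ∑ b : Bool, P d b * R d b x y) *
        ∑ u : Bool, A y u * ∑ l : Bool, S u x l d' * M l b' := by
    simp only [Fintype.sum_bool]; ring
  simp only [h]
  generalize (fun x y => ∑ d : Bool, ∑ b : Bool, P d b * R d b x y) = Q
  simp only [Fintype.sum_bool]
  ring

/-- When the diagonal line has been moved past the first `k` rows only, it must still cross the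
vertical line of column `m - k`; this leftover crossing intertwines the two partial transfer
products. At `k = 0` it is the crossing of two empty lines, whence the factor `(w₃ m).a`. -/
theorem chain_exchange (h : ∀ c, IsYB (w₁ c) w₂ (w₃ c)) (m : ℕ) (L B N E : ℕ → Bool) (k : ℕ)
    (x y : Bool) :
    (w₃ m).a * chain (fun r x y u x' y' => (w₁ (m - r)).weight (L r) y u (B (r + 1)) *
        cVertexWeight (w₁ (m - (r + 1))) w₂ (w₃ (m - (r + 1))) u x (N r) (E r) x' y') k x y =
      ∑ d : Bool, ∑ b : Bool, chain (fun r d b l d' b' =>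
        cVertexWeight (w₁ (m - r)) w₂ (w₃ (m - r)) (L r) d b l d' (B (r + 1)) *
          (w₁ (m - (r + 1))).weight l (N r) (E r) b') k d b * (w₃ (m - k)).weight d b x y := by
  induction k generalizing x y with
  | zero =>
    cases x <;> cases y <;>
      simp only [chain, Fintype.sum_bool, CWeights.weight_table] <;> simp
  | succ k ih =>
    have h1 : (w₃ m).a * chain (fun r x y u x' y' => (w₁ (m - r)).weight (L r) y u (B (r + 1)) *
        cVertexWeight (w₁ (m - (r + 1))) w₂ (w₃ (m - (r + 1))) u x (N r) (E r) x' y') (k + 1) x y =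
        ∑ x' : Bool, ∑ y' : Bool,
        ((w₃ m).a * chain (fun r x y u x' y' => (w₁ (m - r)).weight (L r) y u (B (r + 1)) *
        cVertexWeight (w₁ (m - (r + 1))) w₂ (w₃ (m - (r + 1))) u x (N r) (E r) x' y') k x' y') *
        ∑ u : Bool, (w₁ (m - k)).weight (L k) y' u (B (k + 1)) *
          cVertexWeight (w₁ (m - (k + 1))) w₂ (w₃ (m - (k + 1))) u x' (N k) (E k) x y := by
      simp only [chain, mul_sum, mul_assoc]
    rw [h1]
    -- The induction hypothesis brings the leftover crossing to row `k`; star-triangle then carries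
    -- the line across the inner vertex of that row, releasing a crossing with the next column.
    simp only [ih, ← (h (m - (k + 1))).exchange]
    exact sum_transfer_aux _ (fun d b x y => (w₃ (m - k)).weight d b x y)
      (fun y u => (w₁ (m - k)).weight (L k) y u (B (k + 1)))
      (fun u x l d => w₂.weight u x l d)
      (fun l b => (w₁ (m - (k + 1))).weight l (N k) (E k) b)
      (fun d b => (w₃ (m - (k + 1))).weight d b x y)

/-- A diagonal line can be moved through a layer of the six-vertex model. -/
theorem layer_exchange (h : ∀ c, IsYB (w₁ c) w₂ (w₃ c)) (m : ℕ) (L' B' E N : ℕ → Bool) :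
    ∑ L ∈ (range (m + 1)).powerset, ∑ B ∈ (Ico 1 (m + 1 + 1)).powerset,
        layerSum (local20 w₁ w₂ w₃) (m + 1) L' B' (ind L) (ind B) *
          layerSum (local6 w₁) m (ind L) (ind B) E N =
      w₂.a * (w₃ (m + 1)).a *
        ∑ L ∈ (range (m + 1)).powerset, ∑ B ∈ (Ico 1 (m + 1 + 1)).powerset,
          layerSum (local6 w₁) (m + 1) L' B' (ind L) (ind B) *
            layerSum (local20 w₁ w₂ w₃) m (ind L) (ind B) E N := by
  -- The indices left out of the index sets of `L` and `D` stand for the East boundary edges, which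
  -- are empty.
  have hl : ∀ L ∈ (range (m + 1)).powerset, ind L (m + 1) = false := fun L hL =>
    ind_eq_false fun hh => by simpa using mem_powerset.1 hL hh
  have hd : ∀ D ∈ (Ico 1 (m + 1 + 1)).powerset, ind D (m + 1 + 1) = false := fun L hL =>
    ind_eq_false fun hh => by simpa using mem_powerset.1 hL hh
  have lhs : ∑ L ∈ (range (m + 1)).powerset, ∑ B ∈ (Ico 1 (m + 1 + 1)).powerset,
        layerSum (local20 w₁ w₂ w₃) (m + 1) L' B' (ind L) (ind B) *
          layerSum (local6 w₁) m (ind L) (ind B) E N =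
      ∑ d : Bool, ∑ b : Bool, chain (fun r d b l d' b' =>
        cVertexWeight (w₁ (m + 1 - r)) w₂ (w₃ (m + 1 - r)) (L' r) d b l d' (B' (r + 1)) *
          (w₁ (m + 1 - (r + 1))).weight l (N r) (E r) b') (m + 1) d b *
        cVertexWeight (w₁ 0) w₂ (w₃ 0) (L' (m + 1)) d b false false (B' (m + 1 + 1)) := by
    rw [← sum_powerset_prod_eq_chain _ _ fun d b =>
      cVertexWeight (w₁ 0) w₂ (w₃ 0) (L' (m + 1)) d b false false (B' (m + 1 + 1))]
    refine sum_congr rfl fun L hL => sum_congr rfl fun B _ => ?_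
    rw [layerSum_local6, layerSum, sum_mul]
    refine sum_congr rfl fun D hD => ?_
    rw [layerWeight, prod_range_succ, hl L hL, hd D hD, prod_mul_distrib]
    simp only [local20, Nat.add_sub_add_right, Nat.sub_self]
    ring
  have rhs : ∑ L ∈ (range (m + 1)).powerset, ∑ B ∈ (Ico 1 (m + 1 + 1)).powerset,
          layerSum (local6 w₁) (m + 1) L' B' (ind L) (ind B) *
            layerSum (local20 w₁ w₂ w₃) m (ind L) (ind B) E N =
      ∑ x : Bool, ∑ y : Bool, chain (fun r x y u x' y' =>
        (w₁ (m + 1 - r)).weight (L' r) y u (B' (r + 1)) *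
        cVertexWeight (w₁ (m + 1 - (r + 1))) w₂ (w₃ (m + 1 - (r + 1))) u x (N r) (E r) x' y')
          (m + 1) x y *
        if x = false then (w₁ 0).weight (L' (m + 1)) y false (B' (m + 1 + 1)) else 0 := by
    -- The inner layer has one diagonal edge fewer than the chain provides; the closing factor
    -- forces the superfluous bit to be empty.
    rw [← sum_powerset_prod_eq_chain _ _ fun x y =>
      if x = false then (w₁ 0).weight (L' (m + 1)) y false (B' (m + 1 + 1)) else 0]
    refine sum_congr rfl fun L hL => sum_congr rfl fun B _ => ?_
    have hI : Ico 1 (m + 1 + 1) = insert (m + 1) (Ico 1 (m + 1)) := by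
      ext; grind
    have hk : m + 1 ∉ Ico 1 (m + 1) := by simp
    rw [hI]
    rw [sum_powerset_insert_ind hk fun D => (∏ r ∈ range (m + 1),
        (w₁ (m + 1 - r)).weight (L' r) (ind B r) (ind L r) (B' (r + 1)) *
        cVertexWeight (w₁ (m + 1 - (r + 1))) w₂ (w₃ (m + 1 - (r + 1))) (ind L r) (D r)
          (N r) (E r) (D (r + 1)) (ind B (r + 1))) *
        if D (m + 1) = false then
          (w₁ 0).weight (L' (m + 1)) (ind B (m + 1)) false (B' (m + 1 + 1)) else 0]
    rw [layerSum_local6, layerSum, mul_sum]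
    refine sum_congr rfl fun D hD => ?_
    have hD' : ind D (m + 1) = false := ind_eq_false fun hh => hk (mem_powerset.1 hD hh)
    rw [Fintype.sum_bool, ← hD', Function.update_eq_self, prod_range_succ, layerWeight, hl L hL]
    simp only [local20, Nat.add_sub_add_right, Nat.sub_self, Function.update_self, hD',
      prod_mul_distrib]
    simp
    ring
  rw [lhs, rhs]
  have key := chain_exchange h (m + 1) L' B' N E (m + 1)
  rw [Nat.sub_self] at key
  -- At the last vertex the right and lower right edges are empty, so its horizontal–diagonal
  -- crossing is empty and gives `w₂.a`. Its diagonal–vertical crossing is the one left over by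
  -- `chain_exchange`.
  have h2 : ∀ d b, cVertexWeight (w₁ 0) w₂ (w₃ 0) (L' (m + 1)) d b false false (B' (m + 1 + 1)) =
      w₂.a * ∑ y : Bool, (w₃ 0).weight d b false y *
        (w₁ 0).weight (L' (m + 1)) y false (B' (m + 1 + 1)) := by
    intro d b
    simp only [cVertexWeight, Fintype.sum_bool, CWeights.weight_table]
    ring
  have kf := key false false
  have kt := key false true
  simp only [Fintype.sum_bool] at kf kt
  simp only [h2, Fintype.sum_bool, if_true, Bool.true_eq_false, if_false]
  linear_combination (-w₂.a) * (w₁ 0).weight (L' (m + 1)) false false (B' (m + 1 + 1)) * kf -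
    w₂.a * (w₁ 0).weight (L' (m + 1)) true false (B' (m + 1 + 1)) * kt

/-- At the corner the diagonal line is empty throughout and meets the two other lines where they are
empty, so it detaches. -/
theorem layerSum_local20_zero (L' B' L B : ℕ → Bool) (hL : L 0 = false) (hB : B 0 = false) :
    layerSum (local20 w₁ w₂ w₃) 0 L' B' L B =
      w₂.a * (w₃ 0).a * layerSum (local6 w₁) 0 L' B' L B := by
  simp [layerSum_local6]
  simp [layerSum, layerWeight, local20, hL, hB, ind]
  simp only [cVertexWeight, Fintype.sum_bool, CWeights.weight_table]
  ring

/-- One more layer of the twenty-vertex model around a six-vertex triangle. -/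
theorem sum_layerSum_local20 (h : ∀ c, IsYB (w₁ c) w₂ (w₃ c)) (m : ℕ) (L' B' : ℕ → Bool) :
    ∑ L ∈ (range m).powerset, ∑ B ∈ (Ico 1 (m + 1)).powerset,
        layerSum (local20 w₁ w₂ w₃) m L' B' (ind L) (ind B) *
          layerPartition (local6 w₁) m (ind L) (ind B) =
      (∏ c ∈ range (m + 1), w₂.a * (w₃ c).a) * layerPartition (local6 w₁) (m + 1) L' B' := by
  induction m generalizing L' B' with
  | zero =>
    simp [layerPartition]
    rw [layerSum_local20_zero _ _ _ _ (by simp [ind]) (by simp [ind])]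
  | succ m ih =>
    -- Unfolding one layer of the six-vertex triangle brings the two outermost layers together, as
    -- `layer_exchange` requires.
    have hx : ∀ ω : LocalWeight,
        ∑ L ∈ (range (m + 1)).powerset, ∑ B ∈ (Ico 1 (m + 1 + 1)).powerset,
        layerSum ω (m + 1) L' B' (ind L) (ind B) *
          layerPartition (local6 w₁) (m + 1) (ind L) (ind B) =
        ∑ E ∈ (range m).powerset, ∑ N ∈ (Ico 1 (m + 1)).powerset,
        (∑ L ∈ (range (m + 1)).powerset, ∑ B ∈ (Ico 1 (m + 1 + 1)).powerset,
          layerSum ω (m + 1) L' B' (ind L) (ind B) *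
            layerSum (local6 w₁) m (ind L) (ind B) (ind E) (ind N)) *
          layerPartition (local6 w₁) m (ind E) (ind N) := by
      intro ω
      simp only [layerPartition, mul_sum, sum_mul]
      rw [sum_comm_pairs]
      simp only [mul_assoc]
    rw [hx]
    simp only [layer_exchange h]
    have hy : ∀ L B : Finset ℕ, w₂.a * (w₃ (m + 1)).a *
        (layerSum (local6 w₁) (m + 1) L' B' (ind L) (ind B) *
          ((∏ c ∈ range (m + 1), w₂.a * (w₃ c).a) *
            layerPartition (local6 w₁) (m + 1) (ind L) (ind B))) =
        (∏ c ∈ range (m + 1 + 1), w₂.a * (w₃ c).a) *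
          (layerSum (local6 w₁) (m + 1) L' B' (ind L) (ind B) *
            layerPartition (local6 w₁) (m + 1) (ind L) (ind B)) := by
      intro L B
      rw [prod_range_succ _ (m + 1)]
      ring
    rw [show layerPartition (local6 w₁) (m + 1 + 1) L' B' = ∑ L ∈ (range (m + 1)).powerset,
      ∑ B ∈ (Ico 1 (m + 1 + 1)).powerset, layerSum (local6 w₁) (m + 1) L' B' (ind L) (ind B) *
        layerPartition (local6 w₁) (m + 1) (ind L) (ind B) from rfl]
    simp only [mul_sum, ← hy, ← ih]
    simp only [sum_mul]
    rw [sum_comm_pairs]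
    simp only [mul_assoc]

/-- Removal of all the diagonal lines. -/
theorem layerPartition_local20 (h : ∀ c, IsYB (w₁ c) w₂ (w₃ c)) (m : ℕ) (L' B' : ℕ → Bool) :
    layerPartition (local20 w₁ w₂ w₃) m L' B' =
      (∏ s ∈ range m, ∏ c ∈ range (s + 1), w₂.a * (w₃ c).a) *
        layerPartition (local6 w₁) m L' B' := by
  induction m generalizing L' B' with
  | zero => simp [layerPartition]
  | succ m ih =>
    rw [layerPartition, prod_range_succ, mul_assoc, ← sum_layerSum_local20 h]
    simp only [ih, mul_sum]
    refine sum_congr rfl fun L _ => sum_congr rfl fun B _ => ?_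
    ring

end

/-! ### Decomposing configurations of the triangle into layers -/

/-- The edges `(r, m - r)` with `r ∈ S`. -/
def antidiag (m : ℕ) (S : Finset ℕ) : Finset (ℕ × ℕ) := S.image fun r => (r, m - r)

theorem mem_antidiag_iff {m : ℕ} {S : Finset ℕ} (hS : ∀ r ∈ S, r ≤ m) {r c : ℕ} :
    (r, c) ∈ antidiag m S ↔ r ∈ S ∧ r + c = m := by
  simp only [antidiag, mem_image, Prod.mk.injEq]
  constructor
  · rintro ⟨a, ha, rfl, rfl⟩
    exact ⟨ha, by have := hS a ha; omega⟩
  · rintro ⟨h, rfl⟩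
    exact ⟨r, h, rfl, by omega⟩

theorem mem_antidiag {m : ℕ} {S : Finset ℕ} {r c : ℕ} (h : r + c = m) :
    (r, c) ∈ antidiag m S ↔ r ∈ S := by
  unfold antidiag
  grind

theorem notMem_antidiag {m : ℕ} {S : Finset ℕ} {r c : ℕ} (hS : ∀ r ∈ S, r ≤ m) (h : r + c ≠ m) :
    (r, c) ∉ antidiag m S := by
  rw [mem_antidiag_iff hS]
  exact fun h' => h h'.2

theorem sum_powerset_union_antidiag {E : Finset (ℕ × ℕ)} {m : ℕ} {I : Finset ℕ}
    (hE : ∀ e ∈ E, e.1 + e.2 < m) (hI : ∀ r ∈ I, r ≤ m) (f : Finset (ℕ × ℕ) → ℂ) :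
    ∑ A ∈ (E ∪ antidiag m I).powerset, f A =
      ∑ A ∈ E.powerset, ∑ S ∈ I.powerset, f (A ∪ antidiag m S) := by
  rw [← sum_product']
  symm
  refine sum_nbij' (fun p => p.1 ∪ antidiag m p.2)
    (fun A => (A ∩ E, I.filter fun r => (r, m - r) ∈ A)) ?_ ?_ ?_ ?_ (fun _ _ => rfl)
  · intro p hp
    simp only [mem_product, mem_powerset] at hp ⊢
    exact union_subset_union hp.1 (image_subset_image hp.2)
  · intro A _
    simp only [mem_product, mem_powerset]
    exact ⟨inter_subset_right, filter_subset _ _⟩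
  · rintro ⟨A, S⟩ hp
    simp only [mem_product, mem_powerset] at hp
    have hS : ∀ r ∈ S, r ≤ m := fun r hr => hI r (hp.2 hr)
    ext x
    · obtain ⟨r, c⟩ := x
      have h1 := @hE (r, c)
      have h2 := @hp.1 (r, c)
      have h3 := @notMem_antidiag m S r c hS
      simp only [mem_inter, mem_union]
      grind
    · have h1 := @hE (x, m - x)
      have h2 := @hp.1 (x, m - x)
      have h3 := @hp.2 x
      have h4 := hI x
      have h5 := @mem_antidiag m S x (m - x)
      simp only [mem_filter, mem_union]
      grind
  · intro A hA
    have hA := mem_powerset.1 hA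
    ext ⟨r, c⟩
    have h1 := @hA (r, c)
    have h2 := @hE (r, c)
    simp only [mem_union, mem_inter, antidiag, mem_image, mem_filter] at h1 ⊢
    grind

/-- The edges of the triangle which are not on the North or East boundary. -/
def innerHor (m : ℕ) : Finset (ℕ × ℕ) :=
  (range (m + 1) ×ˢ range (m + 1)).filter fun e => e.1 + e.2 ≤ m ∧ 1 ≤ e.2
def innerDiag (m : ℕ) : Finset (ℕ × ℕ) :=
  (range (m + 1) ×ˢ range (m + 1)).filter fun e => e.1 + e.2 ≤ m ∧ 1 ≤ e.1 ∧ 1 ≤ e.2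
def innerVer (m : ℕ) : Finset (ℕ × ℕ) :=
  (range (m + 1) ×ˢ range (m + 1)).filter fun e => e.1 + e.2 ≤ m ∧ 1 ≤ e.1

theorem mem_innerHor {m : ℕ} {e : ℕ × ℕ} : e ∈ innerHor m ↔ e.1 + e.2 ≤ m ∧ 1 ≤ e.2 := by
  simp only [innerHor, mem_filter, mem_product, mem_range]; omega

theorem mem_innerDiag {m : ℕ} {e : ℕ × ℕ} :
    e ∈ innerDiag m ↔ e.1 + e.2 ≤ m ∧ 1 ≤ e.1 ∧ 1 ≤ e.2 := by
  simp only [innerDiag, mem_filter, mem_product, mem_range]; omega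

theorem mem_innerVer {m : ℕ} {e : ℕ × ℕ} : e ∈ innerVer m ↔ e.1 + e.2 ≤ m ∧ 1 ≤ e.1 := by
  simp only [innerVer, mem_filter, mem_product, mem_range]; omega

theorem innerHor_succ (m : ℕ) :
    innerHor (m + 1) = innerHor m ∪ antidiag (m + 1) (range (m + 1)) := by
  ext ⟨r, c⟩
  rw [mem_union, mem_antidiag_iff (by intro r; simp; omega)]
  simp only [mem_innerHor, mem_range]
  omega

theorem innerDiag_succ (m : ℕ) :
    innerDiag (m + 1) = innerDiag m ∪ antidiag (m + 1) (Ico 1 (m + 1)) := by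
  ext ⟨r, c⟩
  rw [mem_union, mem_antidiag_iff (by intro r; simp; omega)]
  simp only [mem_innerDiag, mem_Ico]
  omega

theorem innerVer_succ (m : ℕ) :
    innerVer (m + 1) = innerVer m ∪ antidiag (m + 1) (Ico 1 (m + 1 + 1)) := by
  ext ⟨r, c⟩
  rw [mem_union, mem_antidiag_iff (by intro r; simp)]
  simp only [mem_innerVer, mem_Ico]
  omega

/-- Product of the local weights over the vertices of the triangle. -/
def TriConfig.localWeight (ω : LocalWeight) (m : ℕ) (C : TriConfig) : ℂ :=
  ∏ v ∈ triVertices m, ω v.1 v.2 (C.hor v.1 (v.2 + 1)) (C.diag v.1 (v.2 + 1)) (C.ver v.1 v.2)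
    (C.hor v.1 v.2) (C.diag (v.1 + 1) v.2) (C.ver (v.1 + 1) v.2)

theorem mem_triVertices {m : ℕ} {v : ℕ × ℕ} : v ∈ triVertices m ↔ v.1 + v.2 < m := by
  simp only [triVertices, mem_filter, mem_product, mem_range]; omega

theorem triVertices_succ (m : ℕ) :
    triVertices (m + 1) = triVertices m ∪ antidiag m (range (m + 1)) := by
  ext ⟨r, c⟩
  rw [mem_union, mem_antidiag_iff (by intro r; simp)]
  simp only [mem_triVertices, mem_range]
  omega

theorem localWeight_succ (ω : LocalWeight) (m : ℕ) (C : TriConfig) :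
    C.localWeight ω (m + 1) = C.localWeight ω m *
      layerWeight ω m (fun r => C.hor r (m + 1 - r)) (fun r => C.ver r (m + 1 - r))
        (fun r => C.diag r (m + 1 - r)) (fun r => C.hor r (m - r)) (fun r => C.ver r (m - r)) := by
  unfold TriConfig.localWeight
  rw [triVertices_succ, prod_union]
  · congr 1
    rw [antidiag, prod_image (by intro a _ b _ h; exact (Prod.mk.inj h).1), layerWeight]
    refine prod_congr rfl fun r hr => ?_
    have hr := mem_range.1 hr
    have h1 : m - r + 1 = m + 1 - r := by omega
    have h2 : m - r = m + 1 - (r + 1) := by omega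
    simp only [h1]
    rw [← h2]
  · rw [disjoint_left]
    rintro ⟨r, c⟩ h
    rw [mem_triVertices] at h
    exact notMem_antidiag (fun r hr => by simpa [Nat.lt_succ_iff] using hr) h.ne

theorem localWeight_congr {ω : LocalWeight} {m : ℕ} {C C' : TriConfig}
    (hh : ∀ r c, r + c ≤ m → C.hor r c = C'.hor r c)
    (hd : ∀ r c, r + c ≤ m → C.diag r c = C'.diag r c)
    (hv : ∀ r c, r + c ≤ m → C.ver r c = C'.ver r c) :
    C.localWeight ω m = C'.localWeight ω m := by
  refine prod_congr rfl fun v hv' => ?_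
  have := mem_triVertices.1 hv'
  rw [hh _ _ (by omega), hh _ _ (by omega), hd _ _ (by omega), hd _ _ (by omega),
    hv _ _ (by omega), hv _ _ (by omega)]

theorem decide_mem_union_antidiag {A : Finset (ℕ × ℕ)} {m : ℕ} {S : Finset ℕ}
    (hA : ∀ e ∈ A, e.1 + e.2 ≤ m) (hS : ∀ r ∈ S, r ≤ m + 1) (r : ℕ) :
    decide ((r, m + 1 - r) ∈ A ∪ antidiag (m + 1) S) = ind S r := by
  have h1 := @hA (r, m + 1 - r)
  have h2 := @mem_antidiag (m + 1) S r (m + 1 - r)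
  have h3 := @notMem_antidiag (m + 1) S r (m + 1 - r) hS
  have h4 := hS r
  unfold ind
  congr 1
  rw [mem_union]
  grind

theorem decide_mem_union_antidiag_of_le {A : Finset (ℕ × ℕ)} {m : ℕ} {S : Finset ℕ}
    (hS : ∀ r ∈ S, r ≤ m + 1) {r c : ℕ} (h : r + c ≤ m) :
    decide ((r, c) ∈ A ∪ antidiag (m + 1) S) = decide ((r, c) ∈ A) := by
  have h3 := @notMem_antidiag (m + 1) S r c hS (by omega)
  simp [h3]

/-- The sum over configurations of the triangle, computed layer by layer. -/
theorem sum_localWeight (ω : LocalWeight) (m : ℕ) (G : (ℕ → Bool) → (ℕ → Bool) → ℂ) :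
    ∑ A ∈ (innerHor m).powerset, ∑ D ∈ (innerDiag m).powerset, ∑ V ∈ (innerVer m).powerset,
      G (fun r => decide ((r, m - r) ∈ A)) (fun r => decide ((r, m - r) ∈ V)) *
        TriConfig.localWeight ω m (A, D, V) =
    ∑ L ∈ (range m).powerset, ∑ B ∈ (Ico 1 (m + 1)).powerset,
      G (ind L) (ind B) * layerPartition ω m (ind L) (ind B) := by
  induction m generalizing G with
  | zero =>
    have h1 : innerHor 0 = ∅ := by ext e; simp [mem_innerHor]
    have h2 : innerDiag 0 = ∅ := by ext e; simp [mem_innerDiag]; omega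
    have h3 : innerVer 0 = ∅ := by ext e; simp [mem_innerVer]; omega
    simp [h1, h2, h3, layerPartition, TriConfig.localWeight, triVertices]
    rfl
  | succ m ih =>
    have e1 : ∀ e ∈ innerHor m, e.1 + e.2 < m + 1 := fun e he => by
      have := mem_innerHor.1 he; omega
    have e2 : ∀ e ∈ innerDiag m, e.1 + e.2 < m + 1 := fun e he => by
      have := mem_innerDiag.1 he; omega
    have e3 : ∀ e ∈ innerVer m, e.1 + e.2 < m + 1 := fun e he => by
      have := mem_innerVer.1 he; omega
    have i1 : ∀ r ∈ range (m + 1), r ≤ m + 1 := fun r hr => by have := mem_range.1 hr; omega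
    have i2 : ∀ r ∈ Ico 1 (m + 1), r ≤ m + 1 := fun r hr => by have := mem_Ico.1 hr; omega
    have i3 : ∀ r ∈ Ico 1 (m + 1 + 1), r ≤ m + 1 := fun r hr => by have := mem_Ico.1 hr; omega
    rw [innerHor_succ, innerDiag_succ, innerVer_succ, sum_powerset_union_antidiag e1 i1]
    simp only [sum_powerset_union_antidiag e2 i2, sum_powerset_union_antidiag e3 i3]
    have key : ∀ A ∈ (innerHor m).powerset, ∀ L ∈ (range (m + 1)).powerset,
        ∀ D ∈ (innerDiag m).powerset, ∀ S ∈ (Ico 1 (m + 1)).powerset,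
        ∀ V ∈ (innerVer m).powerset, ∀ B ∈ (Ico 1 (m + 1 + 1)).powerset,
        G (fun r => decide ((r, m + 1 - r) ∈ A ∪ antidiag (m + 1) L))
          (fun r => decide ((r, m + 1 - r) ∈ V ∪ antidiag (m + 1) B)) *
          TriConfig.localWeight ω (m + 1)
            (A ∪ antidiag (m + 1) L, D ∪ antidiag (m + 1) S, V ∪ antidiag (m + 1) B) =
        G (ind L) (ind B) * (layerWeight ω m (ind L) (ind B) (ind S)
          (fun r => decide ((r, m - r) ∈ A)) (fun r => decide ((r, m - r) ∈ V)) *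
          TriConfig.localWeight ω m (A, D, V)) := by
      intro A hA L hL D hD S hS V hV B hB
      have hA' : ∀ e ∈ A, e.1 + e.2 ≤ m := fun e he => by
        have := e1 e (mem_powerset.1 hA he); omega
      have hD' : ∀ e ∈ D, e.1 + e.2 ≤ m := fun e he => by
        have := e2 e (mem_powerset.1 hD he); omega
      have hV' : ∀ e ∈ V, e.1 + e.2 ≤ m := fun e he => by
        have := e3 e (mem_powerset.1 hV he); omega
      have hL' : ∀ r ∈ L, r ≤ m + 1 := fun r hr => i1 r (mem_powerset.1 hL hr)
      have hS' : ∀ r ∈ S, r ≤ m + 1 := fun r hr => i2 r (mem_powerset.1 hS hr)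
      have hB' : ∀ r ∈ B, r ≤ m + 1 := fun r hr => i3 r (mem_powerset.1 hB hr)
      have c1 : TriConfig.localWeight ω m
            (A ∪ antidiag (m + 1) L, D ∪ antidiag (m + 1) S, V ∪ antidiag (m + 1) B) =
          TriConfig.localWeight ω m (A, D, V) :=
        localWeight_congr (fun r c h => decide_mem_union_antidiag_of_le hL' h)
          (fun r c h => decide_mem_union_antidiag_of_le hS' h)
          (fun r c h => decide_mem_union_antidiag_of_le hB' h)
      rw [localWeight_succ, c1]
      simp only [TriConfig.hor, TriConfig.ver, TriConfig.diag, decide_mem_union_antidiag hA' hL',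
        decide_mem_union_antidiag hD' hS', decide_mem_union_antidiag hV' hB']
      have c2 : layerWeight ω m (fun r => ind L r) (fun r => ind B r) (fun r => ind S r)
          (fun r => decide ((r, m - r) ∈ A ∪ antidiag (m + 1) L))
          (fun r => decide ((r, m - r) ∈ V ∪ antidiag (m + 1) B)) =
          layerWeight ω m (ind L) (ind B) (ind S)
          (fun r => decide ((r, m - r) ∈ A)) (fun r => decide ((r, m - r) ∈ V)) := by
        refine prod_congr rfl fun r hr => ?_
        have hr := mem_range.1 hr
        beta_reduce
        rw [decide_mem_union_antidiag_of_le hL' (by omega),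
          decide_mem_union_antidiag_of_le hB' (by omega)]
      rw [c2]
      ring
    have step : ∀ L ∈ (range (m + 1)).powerset, ∀ B ∈ (Ico 1 (m + 1 + 1)).powerset,
        layerPartition ω (m + 1) (ind L) (ind B) =
        ∑ A ∈ (innerHor m).powerset, ∑ D ∈ (innerDiag m).powerset, ∑ V ∈ (innerVer m).powerset,
        layerSum ω m (ind L) (ind B) (fun r => decide ((r, m - r) ∈ A))
          (fun r => decide ((r, m - r) ∈ V)) * TriConfig.localWeight ω m (A, D, V) := by
      intro L _ B _
      -- The smaller triangle sees the new outer layer as a function of its own diagonal boundary;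
      -- this is the reason for carrying an arbitrary `G`.
      rw [ih (layerSum ω m (ind L) (ind B))]
      rfl
    rw [sum_comm]
    refine sum_congr rfl fun L hL => ?_
    have rhs : ∑ B ∈ (Ico 1 (m + 1 + 1)).powerset,
        G (ind L) (ind B) * layerPartition ω (m + 1) (ind L) (ind B) =
        ∑ B ∈ (Ico 1 (m + 1 + 1)).powerset, ∑ A ∈ (innerHor m).powerset,
        ∑ D ∈ (innerDiag m).powerset, ∑ V ∈ (innerVer m).powerset,
          G (ind L) (ind B) * (layerSum ω m (ind L) (ind B) (fun r => decide ((r, m - r) ∈ A))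
          (fun r => decide ((r, m - r) ∈ V)) * TriConfig.localWeight ω m (A, D, V)) := by
      refine sum_congr rfl fun B hB => ?_
      rw [step L hL B hB]
      simp only [mul_sum]
    rw [rhs, sum_comm (s := (Ico 1 (m + 1 + 1)).powerset) (t := (innerHor m).powerset)]
    refine sum_congr rfl fun A hA => ?_
    rw [sum_comm (s := (Ico 1 (m + 1 + 1)).powerset) (t := (innerDiag m).powerset)]
    refine sum_congr rfl fun D hD => ?_
    rw [sum_comm (s := (Ico 1 (m + 1)).powerset) (t := (innerVer m).powerset),
      sum_comm (s := (Ico 1 (m + 1 + 1)).powerset) (t := (innerVer m).powerset)]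
    refine sum_congr rfl fun V hV => ?_
    rw [sum_comm (s := (Ico 1 (m + 1)).powerset)]
    refine sum_congr rfl fun B hB => ?_
    rw [layerSum, sum_mul, mul_sum]
    refine sum_congr rfl fun S hS => ?_
    exact key A hA L hL D hD S hS V hV B hB

/-! ### Boundary conditions and ice rule -/

/-- The boundary condition along the diagonal boundary. -/
def IsDiagBoundary (m : ℕ) (L B : ℕ → Bool) : Prop :=
  ∀ r < m, (L r = true ↔ r < (m + 1) / 2) ∧ (B (r + 1) = true ↔ m / 2 ≤ r)

/-- The North and East conditions say that certain edges are empty, so they can be built into the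
edge sets. Only the diagonal boundary condition and the ice rule survive as conditions. -/
theorem mem_triConfigs {m : ℕ} {C : TriConfig} :
    C ∈ triConfigs m ↔ (C.1 ∈ (innerHor m).powerset ∧ C.2.1 ∈ (innerDiag m).powerset ∧
      C.2.2 ∈ (innerVer m).powerset) ∧
      IsDiagBoundary m (fun r => C.hor r (m - r)) (fun r => C.ver r (m - r)) ∧ C.IsIce m := by
  have hsub : ∀ r, m - 1 - r = m - (r + 1) := fun r => by omega
  unfold triConfigs
  simp only [mem_filter, mem_product, mem_powerset]
  constructor
  · rintro ⟨⟨h1, h2, h3⟩, ⟨hN, hE, hD⟩, hI⟩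
    refine ⟨⟨fun e he => ?_, fun e he => ?_, fun e he => ?_⟩, fun r hr => ?_, hI⟩
    · have h := h1 he
      simp only [triHorEdges, mem_filter, mem_product, mem_range] at h
      refine mem_innerHor.2 ⟨h.2, Nat.one_le_iff_ne_zero.2 fun h0 => ?_⟩
      have := (hE e.1 h.1.1).1
      rw [← h0] at this
      simp [TriConfig.hor, he] at this
    · have h := h2 he
      simp only [triDiagEdges, mem_filter, mem_product, mem_range] at h
      refine mem_innerDiag.2 ⟨h.2.2, Nat.one_le_iff_ne_zero.2 fun h0 => ?_,
        Nat.one_le_iff_ne_zero.2 fun h0 => ?_⟩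
      · have := (hN (e.2 - 1) (by omega)).2
        rw [Nat.sub_add_cancel (by omega), ← h0] at this
        simp [TriConfig.diag, he] at this
      · have := (hE (e.1 - 1) (by omega)).2
        rw [Nat.sub_add_cancel (by omega), ← h0] at this
        simp [TriConfig.diag, he] at this
    · have h := h3 he
      simp only [triVerEdges, mem_filter, mem_product, mem_range] at h
      refine mem_innerVer.2 ⟨h.2, Nat.one_le_iff_ne_zero.2 fun h0 => ?_⟩
      have := (hN e.2 h.1.2).1
      rw [← h0] at this
      simp [TriConfig.ver, he] at this
    · have := hD r hr
      rwa [hsub] at this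
  · rintro ⟨⟨h1, h2, h3⟩, hB, hI⟩
    refine ⟨⟨fun e he => ?_, fun e he => ?_, fun e he => ?_⟩,
      ⟨fun c hc => ⟨?_, ?_⟩, fun r hr => ⟨?_, ?_⟩, fun r hr => ?_⟩, hI⟩
    · have := mem_innerHor.1 (h1 he)
      simp only [triHorEdges, mem_filter, mem_product, mem_range]
      omega
    · have := mem_innerDiag.1 (h2 he)
      simp only [triDiagEdges, mem_filter, mem_product, mem_range]
      omega
    · have := mem_innerVer.1 (h3 he)
      simp only [triVerEdges, mem_filter, mem_product, mem_range]
      omega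
    · exact decide_eq_false fun he => by simpa using (mem_innerVer.1 (h3 he)).2
    · exact decide_eq_false fun he => by simpa using (mem_innerDiag.1 (h2 he)).2
    · exact decide_eq_false fun he => by simpa using (mem_innerHor.1 (h1 he)).2
    · exact decide_eq_false fun he => by simpa using (mem_innerDiag.1 (h2 he)).2
    · rw [hsub]
      exact hB r hr

/-- Local weights satisfying the ice rule. -/
def LocalWeight.IsIce (ω : LocalWeight) : Prop :=
  ∀ r c W NW N E SE S, W.toNat + NW.toNat + N.toNat ≠ E.toNat + SE.toNat + S.toNat →
    ω r c W NW N E SE S = 0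

/-- In a nonzero term all three crossings conserve paths; adding the three conservation laws cancels
the inner edges. -/
theorem isIce_local20 (w₁ : ℕ → CWeights) (w₂ : CWeights) (w₃ : ℕ → CWeights) :
    (local20 w₁ w₂ w₃).IsIce := by
  intro r c W NW N E SE S h
  unfold local20 cVertexWeight
  refine sum_eq_zero fun x _ => sum_eq_zero fun y _ => sum_eq_zero fun u _ => ?_
  by_contra hne
  have h1 := left_ne_zero_of_mul (left_ne_zero_of_mul hne)
  have h2 := right_ne_zero_of_mul (left_ne_zero_of_mul hne)
  have h3 := right_ne_zero_of_mul hne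
  simp only [CWeights.weight, ne_eq, ite_eq_right_iff, not_forall] at h1 h2 h3
  obtain ⟨h1, _⟩ := h1
  obtain ⟨h2, _⟩ := h2
  obtain ⟨h3, _⟩ := h3
  omega

theorem isIce_local6 (w₁ : ℕ → CWeights) : (local6 w₁).IsIce := by
  intro r c W NW N E SE S h
  unfold local6
  split_ifs with h0
  · rw [CWeights.weight, if_neg]
    simp only [h0.1, h0.2, Bool.toNat_false] at h
    omega
  · rfl

-- Configurations violating the ice rule have weight zero, so the rule can be dropped and the
-- unrestricted layer sum applies.
open Classical in
theorem sum_triConfigs {ω : LocalWeight} (hω : ω.IsIce) (m : ℕ) :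
    ∑ C ∈ triConfigs m, C.localWeight ω m =
      ∑ L ∈ (range m).powerset, ∑ B ∈ (Ico 1 (m + 1)).powerset,
        (if IsDiagBoundary m (ind L) (ind B) then 1 else 0) *
          layerPartition ω m (ind L) (ind B) := by
  rw [← sum_localWeight ω m fun L B => if IsDiagBoundary m L B then 1 else 0]
  simp only [← sum_product', ite_mul, one_mul, zero_mul]
  rw [← sum_filter]
  refine sum_subset (fun C hC => ?_) fun C hC hC' => ?_
  · have h := mem_triConfigs.1 hC
    simp only [mem_filter, mem_product]
    exact ⟨h.1, h.2.1⟩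
  · simp only [mem_filter, mem_product] at hC
    have h : ¬ C.IsIce m := fun h => hC' (mem_triConfigs.2 ⟨hC.1, hC.2, h⟩)
    simp only [TriConfig.IsIce, not_forall] at h
    obtain ⟨v, hv, h⟩ := h
    exact prod_eq_zero hv (hω _ _ _ _ _ _ _ _ h)

/-- Removal of the diagonal lines, for the sum over the configurations of the triangle. -/
theorem sum_triConfigs_local20 {w₁ : ℕ → CWeights} {w₂ : CWeights} {w₃ : ℕ → CWeights}
    (h : ∀ c, IsYB (w₁ c) w₂ (w₃ c)) (m : ℕ) :
    ∑ C ∈ triConfigs m, C.localWeight (local20 w₁ w₂ w₃) m =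
      (∏ s ∈ range m, ∏ c ∈ range (s + 1), w₂.a * (w₃ c).a) *
        ∑ C ∈ triConfigs m, C.localWeight (local6 w₁) m := by
  rw [sum_triConfigs (isIce_local20 w₁ w₂ w₃), sum_triConfigs (isIce_local6 w₁)]
  simp only [layerPartition_local20 h, mul_sum]
  refine sum_congr rfl fun L _ => sum_congr rfl fun B _ => ?_
  ring

/-! ### The rightmost column of the triangle -/

/-- In a column which is empty at the top and occupied at the bottom and loses no path, exactly
one path enters. -/
theorem exists_entrance {m : ℕ} {v : ℕ → Bool} {e : ℕ → ℕ} (h0 : v 0 = false) (hm : v m = true)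
    (h : ∀ r < m, e r + (v r).toNat = (v (r + 1)).toNat) :
    ∃ r₀ < m, (∀ r ≤ m, v r = decide (r₀ < r)) ∧ ∀ r < m, e r = if r = r₀ then 1 else 0 := by
  classical
  have hex : ∃ r, v r = true := ⟨m, hm⟩
  have hmin : ∀ r < Nat.find hex, v r = false := fun r hr => by simpa using Nat.find_min hex hr
  have hle : Nat.find hex ≤ m := Nat.find_le hm
  have hpos : Nat.find hex ≠ 0 := fun h' => by
    have := Nat.find_spec hex
    rw [h', h0] at this
    exact absurd this (by simp)
  have hafter : ∀ r, Nat.find hex ≤ r → r ≤ m → v r = true := by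
    intro r hr
    induction r, hr using Nat.le_induction with
    | base => exact fun _ => Nat.find_spec hex
    | succ k hk ih =>
      intro hkm
      have h1 := h k (by omega)
      rw [ih (by omega)] at h1
      by_contra hc
      simp only [Bool.not_eq_true] at hc
      simp [hc] at h1
  generalize Nat.find hex = r₁ at *
  obtain ⟨r₀, rfl⟩ := Nat.exists_eq_succ_of_ne_zero hpos
  have hv : ∀ r ≤ m, v r = decide (r₀ < r) := by
    intro r hr
    by_cases hrr : r₀ < r
    · rw [hafter r hrr hr, decide_eq_true hrr]
    · rw [hmin r (by omega), decide_eq_false hrr]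
  refine ⟨r₀, hle, hv, fun r hr => ?_⟩
  have h1 := h r hr
  rw [hv r (by omega), hv (r + 1) (by omega)] at h1
  rcases lt_trichotomy r r₀ with h2 | rfl | h2
  · rw [decide_eq_false (by omega), decide_eq_false (by omega)] at h1
    rw [if_neg (by omega)]
    simpa using h1
  · simpa using h1
  · rw [decide_eq_true (by omega), decide_eq_true (by omega)] at h1
    rw [if_neg (by omega)]
    simpa using h1

/-- Weights which are modified in the rightmost column. -/
def columnWeights (w w' : CWeights) (c : ℕ) : CWeights := if c = 0 then w' else w

/-- The rightmost column of a configuration of the triangle. -/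
theorem exists_entrance_tri {m : ℕ} (hm : 1 ≤ m) {C : TriConfig} (hC : C ∈ triConfigs m) :
    ∃ r₀ < m, (∀ r ≤ m, C.ver r 0 = decide (r₀ < r)) ∧
      (∀ r < m, C.hor r 0 = false ∧ C.diag (r + 1) 0 = false) ∧
      (∀ r < m, (C.hor r 1).toNat + (C.diag r 1).toNat = if r = r₀ then 1 else 0) := by
  classical
  obtain ⟨-, ⟨hN, hE, hD⟩, hI⟩ := mem_filter.1 hC
  have hlast : C.ver m 0 = true := by
    have := (hD (m - 1) (by omega)).2.2 (by omega)
    rwa [Nat.sub_self, Nat.sub_add_cancel hm] at this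
  obtain ⟨r₀, hr₀, h1, h2⟩ := exists_entrance (m := m) (v := fun r => C.ver r 0)
    (e := fun r => (C.hor r 1).toNat + (C.diag r 1).toNat) (hN 0 (by omega)).1 hlast
    fun r hr => by
      have := hI (r, 0) (mem_triVertices.2 (by simpa using hr))
      simp only [(hE r hr).1, (hE r hr).2, Bool.toNat_false, zero_add] at this
      exact this
  exact ⟨r₀, hr₀, h1, hE, h2⟩

/-- The visited vertices of the column are those from row `r₀` downwards, and row `r₀`, counted from
`0` at the top, is number `m - r₀` from the bottom. -/
theorem topAt_iff {m k r₀ : ℕ} (hk : k ∈ Icc 1 m) {C : TriConfig} (hr₀ : r₀ < m)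
    (h1 : ∀ r ≤ m, C.ver r 0 = decide (r₀ < r))
    (h2 : ∀ r < m, C.hor r 0 = false ∧ C.diag (r + 1) 0 = false)
    (h3 : ∀ r < m, (C.hor r 1).toNat + (C.diag r 1).toNat = if r = r₀ then 1 else 0) :
    C.TopAt m k ↔ k = m - r₀ := by
  have hk := mem_Icc.1 hk
  have hvis : ∀ r < m, C.Visited r 0 ↔ r₀ ≤ r := by
    intro r hr
    have h3r := h3 r hr
    simp only [TriConfig.Visited, h1 r hr.le, h1 (r + 1) hr, h2 r hr, decide_eq_true_eq]
    constructor
    · intro h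
      by_contra hlt
      rw [if_neg (by omega)] at h3r
      rcases h with h | h | h | h | h | h
      · simp [h] at h3r
      · simp [h] at h3r
      · omega
      · exact absurd h (by simp)
      · exact absurd h (by simp)
      · omega
    · intro h
      right; right; right; right; right
      omega
  unfold TriConfig.TopAt
  rw [hvis (m - k) (by omega)]
  constructor
  · rintro ⟨ha, hb⟩
    by_contra hne
    exact hb r₀ (by omega) ((hvis r₀ hr₀).2 le_rfl)
  · rintro rfl
    refine ⟨by omega, fun r hr => ?_⟩
    rw [hvis r (by omega)]
    omega

/-- Modification of the weights in the rightmost column, for a single configuration. -/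
theorem localWeight_columnWeights {w₁ w₁' w₂ w₃ w₃' : CWeights} {p s qh qd : ℂ}
    (hp : w₁'.a * w₃'.a = p * (w₁.a * w₃.a)) (hs : w₁'.b * w₃'.b = s * (w₁.b * w₃.b))
    (hh : w₃'.a = qh * w₃.a) (hd : w₁'.b = qd * w₁.b) (hc₁ : w₁'.c = w₁.c) (hc₃ : w₃'.c = w₃.c)
    {m r₀ : ℕ} {C : TriConfig} (hr₀ : r₀ < m)
    (h1 : ∀ r ≤ m, C.ver r 0 = decide (r₀ < r))
    (h2 : ∀ r < m, C.hor r 0 = false ∧ C.diag (r + 1) 0 = false)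
    (h3 : ∀ r < m, (C.hor r 1).toNat + (C.diag r 1).toNat = if r = r₀ then 1 else 0) :
    C.localWeight (local20 (columnWeights w₁ w₁') w₂ (columnWeights w₃ w₃')) m =
      (p ^ r₀ * (if C.diag r₀ 1 = true then qd else qh) * s ^ (m - 1 - r₀)) *
        C.localWeight (local20 (fun _ => w₁) w₂ fun _ => w₃) m := by
  -- Ratio of new to old weight in column `0`. Above the entrance the vertex weight is `a₁ a₂ a₃`,
  -- below it `b₁ a₂ b₃`; at the entrance it is `c₁ a₂ a₃` for a horizontal step and `b₁ a₂ c₃` for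
  -- a diagonal one.
  set ρ : ℕ → ℂ := fun r => if r < r₀ then p else if r = r₀ then
    (if C.diag r₀ 1 = true then qd else qh) else s with hρ
  have hprod : ∏ v ∈ triVertices m, (if v.2 = 0 then ρ v.1 else 1) =
      p ^ r₀ * (if C.diag r₀ 1 = true then qd else qh) * s ^ (m - 1 - r₀) := by
    rw [prod_ite, prod_const_one, mul_one]
    have himg : (triVertices m).filter (fun v => v.2 = 0) = (range m).image fun r => (r, 0) := by
      ext ⟨r, c⟩
      simp only [mem_filter, mem_triVertices, mem_image, mem_range, Prod.mk.injEq]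
      constructor
      · rintro ⟨h, rfl⟩
        exact ⟨r, by omega, rfl, rfl⟩
      · rintro ⟨a, h, rfl, rfl⟩
        exact ⟨by omega, rfl⟩
    rw [himg, prod_image (by intro a _ b _ h; exact (Prod.mk.inj h).1)]
    obtain ⟨t, rfl⟩ : ∃ t, m = r₀ + 1 + t := ⟨m - (r₀ + 1), by omega⟩
    rw [prod_range_add, prod_range_succ]
    have e1 : ∏ r ∈ range r₀, ρ r = p ^ r₀ := by
      rw [prod_congr rfl (g := fun _ => p), prod_const, card_range]
      intro r hr
      simp [hρ, mem_range.1 hr]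
    have e2 : ∏ r ∈ range t, ρ (r₀ + 1 + r) = s ^ t := by
      rw [prod_congr rfl (g := fun _ => s), prod_const, card_range]
      intro r hr
      simp only [hρ]
      rw [if_neg (by omega), if_neg (by omega)]
    have e3 : ρ r₀ = if C.diag r₀ 1 = true then qd else qh := by simp [hρ]
    rw [e1, e2, e3]
    congr 2
    omega
  rw [← hprod]
  unfold TriConfig.localWeight
  rw [← prod_mul_distrib]
  refine prod_congr rfl ?_
  rintro ⟨r, c⟩ hv
  have hv := mem_triVertices.1 hv
  simp only at hv ⊢
  rcases Nat.eq_zero_or_pos c with rfl | hcpos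
  · have hr : r < m := by omega
    have h3r := h3 r hr
    simp only [local20, columnWeights, if_true, zero_add, h1 r hr.le, h1 (r + 1) hr, h2 r hr]
    rcases lt_trichotomy r r₀ with hlt | rfl | hgt
    · rw [if_neg (by omega)] at h3r
      have a1 : C.hor r 1 = false := by
        by_contra hx
        simp [hx] at h3r
      have a2 : C.diag r 1 = false := by
        by_contra hx
        simp [hx] at h3r
      rw [a1, a2, decide_eq_false (by omega), decide_eq_false (by omega)]
      simp only [cVertexWeight, Fintype.sum_bool, CWeights.weight_table, hρ, hlt, if_true]
      linear_combination w₂.a * hp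
    · rw [if_pos rfl] at h3r
      rw [decide_eq_false (lt_irrefl _), decide_eq_true (Nat.lt_succ_self _)]
      rcases Bool.eq_false_or_eq_true (C.diag r 1) with hx | hx <;>
      rcases Bool.eq_false_or_eq_true (C.hor r 1) with hy | hy
      · simp [hx, hy] at h3r
      · simp only [cVertexWeight, Fintype.sum_bool, CWeights.weight_table, hρ, hx, hy, lt_irrefl,
          if_true, if_false, hc₃]
        linear_combination w₃.c * w₂.a * hd
      · simp only [cVertexWeight, Fintype.sum_bool, CWeights.weight_table, hρ, hx, hy, lt_irrefl,
          if_true, if_false, hc₁, Bool.false_eq_true]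
        linear_combination w₁.c * w₂.a * hh
      · simp [hx, hy] at h3r
    · rw [if_neg (by omega)] at h3r
      have a1 : C.hor r 1 = false := by
        by_contra hx
        simp [hx] at h3r
      have a2 : C.diag r 1 = false := by
        by_contra hx
        simp [hx] at h3r
      rw [a1, a2, decide_eq_true (by omega), decide_eq_true (by omega)]
      simp only [cVertexWeight, Fintype.sum_bool, CWeights.weight_table, hρ, hgt.not_gt, hgt.ne',
        if_false]
      linear_combination w₂.a * hs
  · simp [local20, columnWeights, hcpos.ne']

theorem coe_totalWeight (w₁ w₂ w₃ : SixWeights) (m : ℕ) (C : TriConfig) :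
    ((C.totalWeight m w₁ w₂ w₃ : ℝ) : ℂ) =
      C.localWeight (local20 (fun _ => w₁.toC) w₂.toC fun _ => w₃.toC) m := by
  simp [TriConfig.totalWeight, TriConfig.localWeight, coe_vertexWeight, local20]

/-- The refined partition function of the twenty-vertex model as a partition function with
weights modified in the rightmost column. -/
theorem sum_localWeight_columnWeights {w₁ w₂ w₃ : SixWeights} {w₁' w₃' : CWeights}
    {p s qh qd : ℂ}
    (hp : w₁'.a * w₃'.a = p * (w₁.a * w₃.a)) (hs : w₁'.b * w₃'.b = s * (w₁.b * w₃.b))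
    (hh : w₃'.a = qh * w₃.a) (hd : w₁'.b = qd * w₁.b) (hc₁ : w₁'.c = w₁.c) (hc₃ : w₃'.c = w₃.c)
    {m : ℕ} (hm : 1 ≤ m) :
    ∑ C ∈ triConfigs m, C.localWeight
        (local20 (columnWeights w₁.toC w₁') w₂.toC (columnWeights w₃.toC w₃')) m =
      ∑ k ∈ Icc 1 m, (qd * ((Z20Diag w₁ w₂ w₃ m k : ℝ) : ℂ) +
        qh * ((Z20Horiz w₁ w₂ w₃ m k : ℝ) : ℂ)) * (s ^ (k - 1) * p ^ (m - k)) := by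
  classical
  simp only [Z20Diag, Z20Horiz, sum_filter, Complex.ofReal_sum, mul_sum, ← sum_add_distrib,
    sum_mul]
  rw [sum_comm]
  refine sum_congr rfl fun C hC => ?_
  obtain ⟨r₀, hr₀, h1, h2, h3⟩ := exists_entrance_tri hm hC
  rw [localWeight_columnWeights (w₁ := w₁.toC) (w₃ := w₃.toC) hp hs hh hd hc₁ hc₃ hr₀ h1 h2 h3,
    ← coe_totalWeight]
  -- Each configuration contributes to a single `k`, and there to exactly one of the horizontal and
  -- diagonal sums.
  rw [sum_eq_single_of_mem (m - r₀) (mem_Icc.2 (by omega))]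
  · have ht : C.TopAt m (m - r₀) := (topAt_iff (mem_Icc.2 (by omega)) hr₀ h1 h2 h3).2 rfl
    have e1 : m - (m - r₀) = r₀ := by omega
    have e2 : m - r₀ - 1 = m - 1 - r₀ := by omega
    have h3r := h3 r₀ hr₀
    rw [if_pos rfl] at h3r
    rw [e1, e2]
    simp only [ht, true_and]
    rcases Bool.eq_false_or_eq_true (C.diag r₀ 1) with hx | hx <;>
    rcases Bool.eq_false_or_eq_true (C.hor r₀ 1) with hy | hy
    · simp [hx, hy] at h3r
    · simp only [hx, hy, if_true, if_false, Bool.false_eq_true, Complex.ofReal_zero]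
      ring
    · simp only [hx, hy, if_true, if_false, Bool.false_eq_true, Complex.ofReal_zero]
      ring
    · simp [hx, hy] at h3r
  · intro k hk hne
    have ht : ¬ C.TopAt m k := fun h => hne ((topAt_iff hk hr₀ h1 h2 h3).1 h)
    simp [ht]

/-! ### The rightmost column of the square -/

/-- Product of column-dependent six-vertex weights over the square grid. -/
def SqConfig.localWeight (w : ℕ → CWeights) (n : ℕ) (C : SqConfig) : ℂ :=
  ∏ v ∈ range n ×ˢ range n,
    (w v.2).weight (C.hor v.1 (v.2 + 1)) (C.ver v.1 v.2) (C.hor v.1 v.2) (C.ver (v.1 + 1) v.2)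

theorem SqConfig.coe_totalWeight (w : SixWeights) (n : ℕ) (C : SqConfig) :
    ((C.totalWeight n w : ℝ) : ℂ) = C.localWeight (fun _ => w.toC) n := by
  simp [SqConfig.totalWeight, SqConfig.localWeight, SixWeights.coe_weight]

/-- The rightmost column of a configuration of the square. -/
theorem exists_entrance_sq {n : ℕ} (hn : 1 ≤ n) {C : SqConfig} (hC : C ∈ sixConfigs n) :
    ∃ r₀ < n, (∀ r ≤ n, C.ver r 0 = decide (r₀ < r)) ∧ (∀ r < n, C.hor r 0 = false) ∧
      (∀ r < n, C.hor r 1 = decide (r = r₀)) := by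
  classical
  obtain ⟨-, ⟨hH, hV⟩, hI⟩ := mem_filter.1 hC
  obtain ⟨r₀, hr₀, h1, h2⟩ := exists_entrance (m := n) (v := fun r => C.ver r 0)
    (e := fun r => (C.hor r 1).toNat) (hV 0 (by omega)).1 (hV 0 (by omega)).2
    fun r hr => by
      have := hI r hr 0 (by omega)
      simp only [(hH r hr).2, Bool.toNat_false, zero_add] at this
      exact this
  refine ⟨r₀, hr₀, h1, fun r hr => (hH r hr).2, fun r hr => ?_⟩
  have := h2 r hr
  by_cases h : r = r₀ <;> simpa [h] using this

theorem SqConfig.topAt_iff {n k r₀ : ℕ} (hk : k ∈ Icc 1 n) {C : SqConfig} (hr₀ : r₀ < n)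
    (h1 : ∀ r ≤ n, C.ver r 0 = decide (r₀ < r)) (h2 : ∀ r < n, C.hor r 0 = false)
    (h3 : ∀ r < n, C.hor r 1 = decide (r = r₀)) :
    C.TopAt n k ↔ k = n - r₀ := by
  have hk := mem_Icc.1 hk
  have hvis : ∀ r < n, C.Visited r 0 ↔ r₀ ≤ r := by
    intro r hr
    simp only [SqConfig.Visited, h1 r hr.le, h1 (r + 1) hr, h2 r hr, zero_add, h3 r hr,
      decide_eq_true_eq]
    simp only [Bool.false_eq_true, false_or]
    omega
  unfold SqConfig.TopAt
  rw [hvis (n - k) (by omega)]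
  constructor
  · rintro ⟨ha, hb⟩
    by_contra hne
    exact hb r₀ (by omega) ((hvis r₀ hr₀).2 le_rfl)
  · rintro rfl
    refine ⟨by omega, fun r hr => ?_⟩
    rw [hvis r (by omega)]
    omega

/-- Column `0` has weights `a` above the entrance, `c` at it and `b` below it, and `c` is unchanged.
-/
theorem SqConfig.localWeight_columnWeights {w w' : CWeights} {p s : ℂ}
    (hp : w'.a = p * w.a) (hs : w'.b = s * w.b) (hc : w'.c = w.c)
    {n r₀ : ℕ} {C : SqConfig} (hr₀ : r₀ < n)
    (h1 : ∀ r ≤ n, C.ver r 0 = decide (r₀ < r)) (h2 : ∀ r < n, C.hor r 0 = false)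
    (h3 : ∀ r < n, C.hor r 1 = decide (r = r₀)) :
    C.localWeight (columnWeights w w') n =
      p ^ r₀ * s ^ (n - 1 - r₀) * C.localWeight (fun _ => w) n := by
  obtain ⟨t, rfl⟩ : ∃ t, n = r₀ + 1 + t := ⟨n - (r₀ + 1), by omega⟩
  set ρ : ℕ → ℂ := fun r => if r < r₀ then p else if r = r₀ then 1 else s with hρ
  have hprod : ∏ r ∈ range (r₀ + 1 + t), ρ r = p ^ r₀ * s ^ t := by
    rw [prod_range_add, prod_range_succ]
    have e1 : ∏ r ∈ range r₀, ρ r = p ^ r₀ := by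
      rw [prod_congr rfl (g := fun _ => p), prod_const, card_range]
      intro r hr
      simp [hρ, mem_range.1 hr]
    have e2 : ∏ r ∈ range t, ρ (r₀ + 1 + r) = s ^ t := by
      rw [prod_congr rfl (g := fun _ => s), prod_const, card_range]
      intro r hr
      simp only [hρ]
      rw [if_neg (by omega), if_neg (by omega)]
    have e3 : ρ r₀ = 1 := by simp [hρ]
    rw [e1, e2, e3, mul_one]
  have ht : r₀ + 1 + t - 1 - r₀ = t := by omega
  rw [ht, ← hprod]
  unfold SqConfig.localWeight
  rw [prod_product, prod_product, ← prod_mul_distrib]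
  refine prod_congr rfl fun r hr => ?_
  have hr := mem_range.1 hr
  rw [show r₀ + 1 + t = r₀ + t + 1 by omega, prod_range_succ', prod_range_succ']
  simp only [columnWeights, Nat.add_eq_zero_iff, one_ne_zero, and_false, if_false, if_true,
    zero_add, h1 r hr.le, h1 (r + 1) hr, h2 r hr, h3 r hr]
  rw [mul_left_comm]
  congr 1
  rcases lt_trichotomy r r₀ with hlt | rfl | hgt
  · rw [decide_eq_false (by omega), decide_eq_false (by omega), decide_eq_false (by omega)]
    simp only [CWeights.weight_table, hρ, hlt, if_true, hp]
  · rw [decide_eq_true (show r = r from rfl), decide_eq_false (show ¬ r < r by omega),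
      decide_eq_true (show r < r + 1 by omega)]
    simp only [CWeights.weight_table, hρ, lt_irrefl, if_true, if_false, hc, one_mul]
  · rw [decide_eq_false (show ¬ r = r₀ by omega), decide_eq_true (show r₀ < r by omega),
      decide_eq_true (show r₀ < r + 1 by omega)]
    simp only [CWeights.weight_table, hρ, hgt.not_gt, hgt.ne', if_false, hs]

/-- The refined partition function of the six-vertex model as a partition function with
weights modified in the rightmost column. -/
theorem SqConfig.sum_localWeight_columnWeights {w : SixWeights} {w' : CWeights} {p s : ℂ}
    (hp : w'.a = p * w.a) (hs : w'.b = s * w.b) (hc : w'.c = w.c) {n : ℕ} (hn : 1 ≤ n) :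
    ∑ C ∈ sixConfigs n, C.localWeight (columnWeights w.toC w') n =
      ∑ k ∈ Icc 1 n, ((Z6 w n k : ℝ) : ℂ) * (s ^ (k - 1) * p ^ (n - k)) := by
  classical
  simp only [Z6, sum_filter, Complex.ofReal_sum, sum_mul]
  rw [sum_comm]
  refine sum_congr rfl fun C hC => ?_
  obtain ⟨r₀, hr₀, h1, h2, h3⟩ := exists_entrance_sq hn hC
  rw [SqConfig.localWeight_columnWeights (w := w.toC) hp hs hc hr₀ h1 h2 h3,
    ← SqConfig.coe_totalWeight]
  rw [sum_eq_single_of_mem (n - r₀) (mem_Icc.2 (by omega))]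
  · have ht : C.TopAt n (n - r₀) := (SqConfig.topAt_iff (mem_Icc.2 (by omega)) hr₀ h1 h2 h3).2 rfl
    have e1 : n - (n - r₀) = r₀ := by omega
    have e2 : n - r₀ - 1 = n - 1 - r₀ := by omega
    rw [e1, e2, if_pos ht]
    ring
  · intro k hk hne
    have ht : ¬ C.TopAt n k := fun h => hne ((SqConfig.topAt_iff hk hr₀ h1 h2 h3).1 h)
    simp [ht]

/-! ### Freezing outside the square -/

/-- Along a line all of whose incoming transverse edges are occupied and whose last edge is empty,
all outgoing transverse edges are occupied and the line is empty. -/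
theorem frozen_line {k : ℕ} {x y h : ℕ → Bool} (hx : ∀ i < k, x i = true) (hk : h k = false)
    (hI : ∀ i < k, (x i).toNat + (h i).toNat = (y i).toNat + (h (i + 1)).toNat) :
    ∀ i < k, y i = true ∧ h i = false := by
  induction k with
  | zero => simp
  | succ k ih =>
    have h1 := hI k (by omega)
    rw [hx k (by omega), hk] at h1
    have h2 : y k = true ∧ h k = false := by
      rcases Bool.eq_false_or_eq_true (y k) with h3 | h3 <;>
      rcases Bool.eq_false_or_eq_true (h k) with h4 | h4 <;> simp [h3, h4] at h1 ⊢
    intro i hi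
    rcases Nat.lt_succ_iff_lt_or_eq.1 hi with hi | rfl
    · exact ih (fun i hi => hx i (by omega)) h2.2 (fun i hi => hI i (by omega)) i hi
    · exact h2

section

variable {m n : ℕ} {C : TriConfig}

/-- Outside the square, the six-vertex configurations of the triangle are frozen. -/
theorem frozen_region (hC : C ∈ triConfigs m) (hd : C.2.1 = ∅) (hn : m / 2 + n = m) :
    (∀ r c, n ≤ c → r + c ≤ m → C.hor r c = decide (r < n) ∧ C.ver r c = false) ∧
    (∀ r c, n ≤ r → r + c ≤ m → C.hor r c = false ∧ C.ver r c = decide (c < n)) := by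
  -- The equation `m / 2 + n = m` says that `n` is half of `m` rounded up, so `m = 2n` and `m = 2n -
  -- 1` are handled together.
  have hnm : (m + 1) / 2 = n := by omega
  obtain ⟨⟨s1, -, s3⟩, hB, hI⟩ := mem_triConfigs.1 hC
  have s1 := mem_powerset.1 s1
  have s3 := mem_powerset.1 s3
  have hdiag : ∀ r c, C.diag r c = false := fun r c => by simp [TriConfig.diag, hd]
  have hor0 : ∀ r, C.hor r 0 = false := fun r =>
    decide_eq_false fun he => by simpa using (mem_innerHor.1 (s1 he)).2
  have ver0 : ∀ c, C.ver 0 c = false := fun c =>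
    decide_eq_false fun he => by simpa using (mem_innerVer.1 (s3 he)).2
  have horB : ∀ r c, r + c = m → C.hor r c = decide (r < n) := by
    intro r c h
    rcases Nat.eq_zero_or_pos c with rfl | hc
    · rw [hor0, decide_eq_false (by omega)]
    · have := (hB r (by omega)).1
      simp only [hnm, show m - r = c by omega] at this
      by_cases hr : r < n
      · simp [hr, this.2 hr]
      · simp [hr] at this ⊢
        exact this
  have verB : ∀ r c, r + c = m → C.ver r c = decide (c < n) := by
    intro r c h
    rcases Nat.eq_zero_or_pos r with rfl | hr
    · rw [ver0, decide_eq_false (by omega)]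
    · have := (hB (r - 1) (by omega)).2
      simp only [Nat.sub_add_cancel hr, show m - r = c by omega] at this
      by_cases hc : c < n
      · rw [this.2 (by omega), decide_eq_true hc]
      · rw [decide_eq_false hc, ← Bool.not_eq_true, this]
        omega
  have ice : ∀ r c, r + c < m → (C.hor r (c + 1)).toNat + (C.ver r c).toNat =
      (C.hor r c).toNat + (C.ver (r + 1) c).toNat := by
    intro r c h
    have := hI (r, c) (mem_triVertices.2 h)
    simpa [hdiag] using this
  constructor
  · intro r c hc hrc
    -- Induction over columns from the far left: every horizontal edge entering column `c` is
    -- occupied and the bottom edge of the column is empty, so `frozen_line` applies.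
    obtain ⟨t, ht⟩ : ∃ t, c + t = m := ⟨m - c, by omega⟩
    induction t generalizing r c with
    | zero =>
      obtain rfl : r = 0 := by omega
      exact ⟨horB _ _ (by omega), ver0 _⟩
    | succ t ih =>
      have key := frozen_line (k := m - c) (x := fun i => C.hor i (c + 1)) (y := fun i => C.hor i c)
        (h := fun i => C.ver i c)
        (fun i hi => by
          have := (ih i (c + 1) (by omega) (by omega) (by omega)).1
          rw [this, decide_eq_true (by omega)])
        (by
          have := verB (m - c) c (by omega)
          rw [this, decide_eq_false (by omega)])
        (fun i hi => ice i c (by omega))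
      rcases Nat.lt_or_ge r (m - c) with hr | hr
      · have := key r hr
        refine ⟨?_, this.2⟩
        rw [decide_eq_true (by omega)]
        exact this.1
      · refine ⟨horB _ _ (by omega), ?_⟩
        rw [verB _ _ (by omega), decide_eq_false (by omega)]
  · intro r c hr hrc
    -- The reflected argument, over rows from the bottom: the paths are followed backwards, upwards
    -- from the bottom edges, and each row ends on the left at an empty boundary edge.
    obtain ⟨t, ht⟩ : ∃ t, r + t = m := ⟨m - r, by omega⟩
    induction t generalizing r c with
    | zero =>
      obtain rfl : c = 0 := by omega
      exact ⟨hor0 _, verB _ _ (by omega)⟩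
    | succ t ih =>
      have key := frozen_line (k := m - r) (x := fun i => C.ver (r + 1) i) (y := fun i => C.ver r i)
        (h := fun i => C.hor r i)
        (fun i hi => by
          have := (ih (r + 1) i (by omega) (by omega) (by omega)).2
          rw [this, decide_eq_true (by omega)])
        (by
          have := horB r (m - r) (by omega)
          rw [this, decide_eq_false (by omega)])
        (fun i hi => by
          have := ice r i (by omega)
          omega)
      rcases Nat.lt_or_ge c (m - r) with hc | hc
      · have := key c hc
        refine ⟨this.2, ?_⟩
        rw [decide_eq_true (by omega)]
        exact this.1
      · refine ⟨?_, verB _ _ (by omega)⟩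
        rw [horB _ _ (by omega), decide_eq_false (by omega)]

end

/-! ### Correspondence between triangle and square configurations -/

/-- The restriction to the square of a configuration of the triangle. -/
def TriConfig.toSq (n : ℕ) (C : TriConfig) : SqConfig :=
  (C.1 ∩ range n ×ˢ range (n + 1), C.2.2 ∩ range (n + 1) ×ˢ range n)

/-- The extension to the triangle of a configuration of the square. -/
def SqConfig.toTri (m n : ℕ) (C : SqConfig) : TriConfig :=
  (C.1 ∪ (innerHor m).filter (fun e => e.1 < n ∧ n ≤ e.2), ∅,
    C.2 ∪ (innerVer m).filter (fun e => e.2 < n ∧ n ≤ e.1))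

theorem TriConfig.toSq_hor {n : ℕ} (C : TriConfig) {r c : ℕ} (hr : r < n) (hc : c ≤ n) :
    (C.toSq n).hor r c = C.hor r c := by
  simp [TriConfig.toSq, SqConfig.hor, TriConfig.hor, hr, hc]

theorem TriConfig.toSq_ver {n : ℕ} (C : TriConfig) {r c : ℕ} (hr : r ≤ n) (hc : c < n) :
    (C.toSq n).ver r c = C.ver r c := by
  simp [TriConfig.toSq, SqConfig.ver, TriConfig.ver, hr, hc]

section

variable {m n : ℕ}

theorem triConfig_ice {C : TriConfig} (hC : C ∈ triConfigs m) (hd : C.2.1 = ∅) {r c : ℕ}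
    (h : r + c < m) : (C.hor r (c + 1)).toNat + (C.ver r c).toNat =
      (C.hor r c).toNat + (C.ver (r + 1) c).toNat := by
  have hdiag : ∀ r c, C.diag r c = false := fun r c => by simp [TriConfig.diag, hd]
  have := (mem_triConfigs.1 hC).2.2 (r, c) (mem_triVertices.2 h)
  simpa [hdiag] using this

theorem toSq_mem {C : TriConfig} (hC : C ∈ triConfigs m) (hd : C.2.1 = ∅) (hn : m / 2 + n = m) :
    C.toSq n ∈ sixConfigs n := by
  classical
  obtain ⟨⟨s1, -, s3⟩, -, -⟩ := mem_triConfigs.1 hC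
  obtain ⟨f1, f2⟩ := frozen_region hC hd hn
  refine mem_filter.2 ⟨mem_product.2 ⟨mem_powerset.2 inter_subset_right,
    mem_powerset.2 inter_subset_right⟩, ⟨fun r hr => ⟨?_, ?_⟩, fun c hc => ⟨?_, ?_⟩⟩,
    fun r hr c hc => ?_⟩
  · rw [C.toSq_hor hr le_rfl, (f1 r n le_rfl (by omega)).1, decide_eq_true hr]
  · rw [C.toSq_hor hr (by omega)]
    exact decide_eq_false fun he => by simpa using (mem_innerHor.1 (mem_powerset.1 s1 he)).2
  · rw [C.toSq_ver (by omega) hc]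
    exact decide_eq_false fun he => by simpa using (mem_innerVer.1 (mem_powerset.1 s3 he)).2
  · rw [C.toSq_ver le_rfl hc, (f2 n c le_rfl (by omega)).2, decide_eq_true hc]
  · rw [C.toSq_hor hr (by omega), C.toSq_hor hr (by omega), C.toSq_ver (by omega) hc,
      C.toSq_ver (by omega) hc]
    exact triConfig_ice hC hd (by omega)

theorem SqConfig.hor_bound {C : SqConfig} (hC : C ∈ sixConfigs n) {e : ℕ × ℕ} (he : e ∈ C.1) :
    e.1 < n ∧ e.2 ≤ n ∧ 1 ≤ e.2 := by
  classical
  obtain ⟨h, ⟨hH, -⟩, -⟩ := mem_filter.1 hC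
  have h1 := mem_product.1 (mem_powerset.1 (mem_product.1 h).1 he)
  simp only [mem_range] at h1
  refine ⟨h1.1, by omega, Nat.one_le_iff_ne_zero.2 fun h0 => ?_⟩
  have := (hH e.1 h1.1).2
  rw [← h0] at this
  simp [SqConfig.hor, he] at this

theorem SqConfig.ver_bound {C : SqConfig} (hC : C ∈ sixConfigs n) {e : ℕ × ℕ} (he : e ∈ C.2) :
    e.1 ≤ n ∧ e.2 < n ∧ 1 ≤ e.1 := by
  classical
  obtain ⟨h, ⟨-, hV⟩, -⟩ := mem_filter.1 hC
  have h1 := mem_product.1 (mem_powerset.1 (mem_product.1 h).2 he)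
  simp only [mem_range] at h1
  refine ⟨by omega, h1.2, Nat.one_le_iff_ne_zero.2 fun h0 => ?_⟩
  have := (hV e.2 h1.2).1
  rw [← h0] at this
  simp [SqConfig.ver, he] at this

theorem toTri_values {C : SqConfig} (hC : C ∈ sixConfigs n) (hn : m / 2 + n = m) :
    (∀ r c, n ≤ c → r + c ≤ m → (C.toTri m n).hor r c = decide (r < n) ∧
      (C.toTri m n).ver r c = false) ∧
    (∀ r c, n ≤ r → r + c ≤ m → (C.toTri m n).hor r c = false ∧
      (C.toTri m n).ver r c = decide (c < n)) ∧
    (∀ r c, r < n → c ≤ n → (C.toTri m n).hor r c = C.hor r c) ∧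
    (∀ r c, r ≤ n → c < n → (C.toTri m n).ver r c = C.ver r c) := by
  classical
  obtain ⟨-, ⟨hH, hV⟩, -⟩ := mem_filter.1 hC
  have hh : ∀ r c, (C.toTri m n).hor r c = true ↔
      ((r, c) ∈ C.1 ∨ (r + c ≤ m ∧ 1 ≤ c) ∧ r < n ∧ n ≤ c) := fun r c => by
    simp [SqConfig.toTri, TriConfig.hor, mem_innerHor]
  have hv : ∀ r c, (C.toTri m n).ver r c = true ↔
      ((r, c) ∈ C.2 ∨ (r + c ≤ m ∧ 1 ≤ r) ∧ c < n ∧ n ≤ r) := fun r c => by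
    simp [SqConfig.toTri, TriConfig.ver, mem_innerVer]
  have bh := fun r c => @SqConfig.hor_bound n C hC (r, c)
  have bv := fun r c => @SqConfig.ver_bound n C hC (r, c)
  refine ⟨fun r c hc hrc => ⟨?_, ?_⟩, fun r c hr hrc => ⟨?_, ?_⟩, fun r c hr hc => ?_,
    fun r c hr hc => ?_⟩
  · rw [Bool.eq_iff_iff, hh, decide_eq_true_eq]
    refine ⟨fun h => h.elim (fun h => (bh r c h).1) (fun h => h.2.1), fun h => ?_⟩
    exact Or.inr ⟨⟨hrc, by omega⟩, h, hc⟩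
  · rw [← Bool.not_eq_true, hv]
    rintro (h | h)
    · have := bv r c h
      simp only at this
      omega
    · omega
  · rw [← Bool.not_eq_true, hh]
    rintro (h | h)
    · have := bh r c h
      simp only at this
      omega
    · omega
  · rw [Bool.eq_iff_iff, hv, decide_eq_true_eq]
    refine ⟨fun h => h.elim (fun h => (bv r c h).2.1) (fun h => h.2.1), fun h => ?_⟩
    exact Or.inr ⟨⟨hrc, by omega⟩, h, hr⟩
  · rw [Bool.eq_iff_iff, hh, SqConfig.hor, decide_eq_true_eq]
    refine ⟨fun h => h.elim id fun h => ?_, Or.inl⟩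
    -- The edges added by the extension overlap the square only on its left side, where the domain
    -- wall condition already makes them occupied.
    obtain rfl : c = n := by omega
    simpa [SqConfig.hor] using (hH r hr).1
  · rw [Bool.eq_iff_iff, hv, SqConfig.ver, decide_eq_true_eq]
    refine ⟨fun h => h.elim id fun h => ?_, Or.inl⟩
    obtain rfl : r = n := by omega
    simpa [SqConfig.ver] using (hV c hc).2

theorem toTri_mem {C : SqConfig} (hC : C ∈ sixConfigs n) (hn : m / 2 + n = m) :
    C.toTri m n ∈ triConfigs m := by
  classical
  obtain ⟨v1, v2, v3, v4⟩ := toTri_values hC hn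
  obtain ⟨-, -, hI⟩ := mem_filter.1 hC
  have hd : ∀ r c, (C.toTri m n).diag r c = false := fun r c => by
    simp [TriConfig.diag, SqConfig.toTri]
  refine mem_triConfigs.2 ⟨⟨?_, ?_, ?_⟩, fun r hr => ⟨?_, ?_⟩, ?_⟩
  · refine mem_powerset.2 (union_subset (fun e he => mem_innerHor.2 ?_) (filter_subset _ _))
    have := SqConfig.hor_bound hC he
    omega
  · exact mem_powerset.2 (empty_subset _)
  · refine mem_powerset.2 (union_subset (fun e he => mem_innerVer.2 ?_) (filter_subset _ _))
    have := SqConfig.ver_bound hC he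
    omega
  · beta_reduce
    rcases Nat.lt_or_ge r n with h | h
    · rw [(v1 r (m - r) (by omega) (by omega)).1, decide_eq_true_eq]
      omega
    · rw [(v2 r (m - r) (by omega) (by omega)).1]
      simp only [Bool.false_eq_true, false_iff]
      omega
  · beta_reduce
    rcases Nat.lt_or_ge r (m / 2) with h | h
    · rw [(v1 (r + 1) (m - (r + 1)) (by omega) (by omega)).2]
      simp only [Bool.false_eq_true, false_iff]
      omega
    · rw [(v2 (r + 1) (m - (r + 1)) (by omega) (by omega)).2, decide_eq_true_eq]
      omega
  · rintro ⟨r, c⟩ hrc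
    have hrc := mem_triVertices.1 hrc
    simp only [hd, Bool.toNat_false, add_zero] at hrc ⊢
    rcases Nat.lt_or_ge c n with hc | hc
    · rcases Nat.lt_or_ge r n with hr | hr
      · rw [v3 _ _ hr (by omega), v3 _ _ hr (by omega), v4 _ _ (by omega) hc,
          v4 _ _ (by omega) hc]
        exact hI r hr c hc
      · rw [(v2 r (c + 1) hr (by omega)).1, (v2 r c hr (by omega)).1,
          (v2 r c hr (by omega)).2, (v2 (r + 1) c (by omega) (by omega)).2]
    · rw [(v1 r (c + 1) (by omega) (by omega)).1, (v1 r c hc (by omega)).1,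
        (v1 r c hc (by omega)).2, (v1 (r + 1) c (by omega) (by omega)).2]

theorem toSq_toTri {C : SqConfig} (hC : C ∈ sixConfigs n) (hn : m / 2 + n = m) :
    (C.toTri m n).toSq n = C := by
  obtain ⟨-, -, v3, v4⟩ := toTri_values hC hn
  refine Prod.ext ?_ ?_
  · ext ⟨r, c⟩
    have b := @SqConfig.hor_bound n C hC (r, c)
    have h3 := v3 r c
    simp only [TriConfig.hor, SqConfig.hor, decide_eq_decide] at h3
    simp only [TriConfig.toSq, mem_inter, mem_product, mem_range]
    exact ⟨fun h => (h3 h.2.1 (by omega)).1 h.1,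
      fun h => ⟨(h3 (b h).1 (b h).2.1).2 h, (b h).1, Nat.lt_succ_of_le (b h).2.1⟩⟩
  · ext ⟨r, c⟩
    have b := @SqConfig.ver_bound n C hC (r, c)
    have h3 := v4 r c
    simp only [TriConfig.ver, SqConfig.ver, decide_eq_decide] at h3
    simp only [TriConfig.toSq, mem_inter, mem_product, mem_range]
    exact ⟨fun h => (h3 (by omega) h.2.2).1 h.1,
      fun h => ⟨(h3 (b h).1 (b h).2.1).2 h, Nat.lt_succ_of_le (b h).1, (b h).2.1⟩⟩

theorem toTri_toSq {C : TriConfig} (hC : C ∈ triConfigs m) (hd : C.2.1 = ∅) (hn : m / 2 + n = m) :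
    (C.toSq n).toTri m n = C := by
  obtain ⟨⟨s1, -, s3⟩, -, -⟩ := mem_triConfigs.1 hC
  obtain ⟨f1, f2⟩ := frozen_region hC hd hn
  refine Prod.ext ?_ (Prod.ext hd.symm ?_)
  · ext ⟨r, c⟩
    have hi := fun h : (r, c) ∈ _ => mem_innerHor.1 (mem_powerset.1 s1 h)
    have g1 := f1 r c
    have g2 := f2 r c
    simp only [TriConfig.hor, decide_eq_decide, decide_eq_false_iff_not] at g1 g2
    simp only [SqConfig.toTri, TriConfig.toSq, mem_union, mem_inter, mem_product, mem_range,
      mem_filter, mem_innerHor]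
    constructor
    · rintro (h | h)
      · exact h.1
      · exact (g1 h.2.2 h.1.1).1.2 h.2.1
    · intro h
      have hi := hi h
      simp only at hi
      have hr : r < n := by
        by_contra hr
        exact (g2 (by omega) hi.1).1 h
      rcases Nat.lt_or_ge c n with hc | hc
      · exact Or.inl ⟨h, hr, by omega⟩
      · exact Or.inr ⟨hi, hr, hc⟩
  · ext ⟨r, c⟩
    have hi := fun h : (r, c) ∈ _ => mem_innerVer.1 (mem_powerset.1 s3 h)
    have g1 := f1 r c
    have g2 := f2 r c
    simp only [TriConfig.ver, decide_eq_decide, decide_eq_false_iff_not] at g1 g2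
    simp only [SqConfig.toTri, TriConfig.toSq, mem_union, mem_inter, mem_product, mem_range,
      mem_filter, mem_innerVer]
    constructor
    · rintro (h | h)
      · exact h.1
      · exact (g2 h.2.2 h.1.1).2.2 h.2.1
    · intro h
      have hi := hi h
      simp only at hi
      have hc : c < n := by
        by_contra hc
        exact (g1 (by omega) hi.1).2 h
      rcases Nat.lt_or_ge r n with hr | hr
      · exact Or.inl ⟨h, by omega, hc⟩
      · exact Or.inr ⟨hi, hc, hr⟩

/-- The vertices of the triangle lying outside the square. -/
def outerVertices (m n : ℕ) : Finset (ℕ × ℕ) := triVertices m \ range n ×ˢ range n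

theorem square_subset_triVertices (hn : m / 2 + n = m) : range n ×ˢ range n ⊆ triVertices m := by
  intro v hv
  simp only [mem_product, mem_range] at hv
  exact mem_triVertices.2 (by omega)

/-- A frozen vertex is crossed by exactly one path going straight, vertically below the square and
horizontally to its left, so its weight is `b`. -/
theorem localWeight_local6 (w : ℕ → CWeights) {C : TriConfig} (hC : C ∈ triConfigs m)
    (hd : C.2.1 = ∅) (hn : m / 2 + n = m) :
    C.localWeight (local6 w) m =
      (∏ v ∈ outerVertices m n, (w v.2).b) * (C.toSq n).localWeight w n := by
  obtain ⟨f1, f2⟩ := frozen_region hC hd hn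
  have hdiag : ∀ r c, C.diag r c = false := fun r c => by simp [TriConfig.diag, hd]
  unfold TriConfig.localWeight SqConfig.localWeight outerVertices
  rw [← prod_sdiff (square_subset_triVertices hn)]
  simp only [local6, hdiag, and_self, if_true]
  congr 1
  · refine prod_congr rfl ?_
    rintro ⟨r, c⟩ hv
    simp only [mem_sdiff, mem_triVertices, mem_product, mem_range] at hv
    simp only
    rcases Nat.lt_or_ge c n with hc | hc
    · rw [(f2 r (c + 1) (by omega) (by omega)).1, (f2 r c (by omega) (by omega)).1,
        (f2 r c (by omega) (by omega)).2, (f2 (r + 1) c (by omega) (by omega)).2,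
        decide_eq_true hc]
      exact (w c).weight_table.2.2.2.1
    · rw [(f1 r (c + 1) (by omega) (by omega)).1, (f1 r c hc (by omega)).1,
        (f1 r c hc (by omega)).2, (f1 (r + 1) c (by omega) (by omega)).2,
        decide_eq_true (by omega)]
      exact (w c).weight_table.2.2.1
  · refine prod_congr rfl ?_
    rintro ⟨r, c⟩ hv
    simp only [mem_product, mem_range] at hv
    simp only
    rw [C.toSq_hor hv.1 hv.2, C.toSq_hor hv.1 hv.2.le, C.toSq_ver hv.1.le hv.2,
      C.toSq_ver hv.1 hv.2]

/-- The six-vertex model on the triangle reduces to the model on the square. -/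
theorem sum_triConfigs_local6 (w : ℕ → CWeights) (hn : m / 2 + n = m) :
    ∑ C ∈ triConfigs m, C.localWeight (local6 w) m =
      (∏ v ∈ outerVertices m n, (w v.2).b) * ∑ C ∈ sixConfigs n, C.localWeight w n := by
  classical
  rw [← sum_filter_of_ne (p := fun C : TriConfig => C.2.1 = ∅), mul_sum]
  · refine sum_nbij' (fun C => C.toSq n) (fun C => C.toTri m n) (fun C hC => ?_) (fun C hC => ?_)
      (fun C hC => ?_) (fun C hC => ?_) (fun C hC => ?_)
    · exact toSq_mem (mem_filter.1 hC).1 (mem_filter.1 hC).2 hn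
    · exact mem_filter.2 ⟨toTri_mem hC hn, rfl⟩
    · exact toTri_toSq (mem_filter.1 hC).1 (mem_filter.1 hC).2 hn
    · exact toSq_toTri hC hn
    · exact localWeight_local6 w (mem_filter.1 hC).1 (mem_filter.1 hC).2 hn
  · intro C hC hne
    by_contra hd
    obtain ⟨⟨r, c⟩, he⟩ := nonempty_iff_ne_empty.2 hd
    have hb := mem_innerDiag.1 (mem_powerset.1 (mem_triConfigs.1 hC).1.2.1 he)
    simp only at hb
    -- An occupied diagonal edge `(r, c)` is the lower right edge of the vertex `(r - 1, c)`, whose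
    -- weight then vanishes.
    refine hne (prod_eq_zero (i := (r - 1, c)) (mem_triVertices.2 (by simp only; omega)) ?_)
    have : C.diag (r - 1 + 1) c = true := by
      rw [Nat.sub_add_cancel hb.2.1]
      exact decide_eq_true he
    simp [local6, this]

end

/-! ### Counting the extracted factors and assembling the identity -/

theorem card_triVertices (m : ℕ) : (triVertices m).card = ∑ s ∈ range m, (s + 1) := by
  induction m with
  | zero => simp [triVertices]
  | succ m ih =>
    rw [triVertices_succ, card_union_of_disjoint, ih, sum_range_succ, antidiag,
      card_image_of_injective _ (fun a b h => (Prod.mk.inj h).1), card_range]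
    rw [disjoint_left]
    rintro ⟨r, c⟩ h
    rw [mem_triVertices] at h
    exact notMem_antidiag (fun r hr => by simpa [Nat.lt_succ_iff] using hr) h.ne

theorem sum_range_succ_mul_two (m : ℕ) : (∑ s ∈ range m, (s + 1)) * 2 = m * (m + 1) := by
  induction m with
  | zero => rfl
  | succ m ih => rw [sum_range_succ, add_mul, ih]; ring

theorem card_outerVertices {m n : ℕ} (hn : m / 2 + n = m) :
    (outerVertices m n).card = (∑ s ∈ range m, (s + 1)) - n * n := by
  rw [outerVertices, card_sdiff_of_subset (square_subset_triVertices hn), card_triVertices,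
    card_product, card_range]

/-- Of the `m` vertices of column `0`, the square contains `n`; the remaining `m - n = m / 2` carry
the modified weight. -/
theorem prod_outerVertices {m n : ℕ} (hn : m / 2 + n = m) {w w' : CWeights} {q : ℂ}
    (hq : w'.b = q * w.b) (hnpos : 1 ≤ n) :
    ∏ v ∈ outerVertices m n, (columnWeights w w' v.2).b =
      w.b ^ ((∑ s ∈ range m, (s + 1)) - n * n) * q ^ (m / 2) := by
  have h : ∀ v ∈ outerVertices m n, (columnWeights w w' v.2).b =
      w.b * if v.2 = 0 then q else 1 := by
    intro v _
    unfold columnWeights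
    split_ifs
    · rw [hq, mul_comm]
    · rw [mul_one]
  rw [prod_congr rfl h, prod_mul_distrib, prod_const, card_outerVertices hn, prod_ite,
    prod_const_one, mul_one, prod_const]
  congr 2
  have : (outerVertices m n).filter (fun v => v.2 = 0) =
      (range (m / 2)).image fun r => (n + r, 0) := by
    ext ⟨r, c⟩
    simp only [outerVertices, mem_filter, mem_sdiff, mem_triVertices, mem_product, mem_image,
      mem_range, Prod.mk.injEq]
    constructor
    · rintro ⟨h, rfl⟩
      exact ⟨r - n, by omega, by omega, rfl⟩
    · rintro ⟨a, h, rfl, rfl⟩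
      omega
  rw [this, card_image_of_injective _ (fun a b h => by simpa using h), card_range]

/-- Each of the `m` diagonal lines crosses the modified column exactly once. -/
theorem prod_diagonals (m : ℕ) {w₂ w w' : CWeights} {q : ℂ} (hq : w'.a = q * w.a) :
    ∏ s ∈ range m, ∏ c ∈ range (s + 1), w₂.a * (columnWeights w w' c).a =
      (w₂.a * w.a) ^ (∑ s ∈ range m, (s + 1)) * q ^ m := by
  have h : ∀ s ∈ range m, ∏ c ∈ range (s + 1), w₂.a * (columnWeights w w' c).a =
      (w₂.a * w.a) ^ (s + 1) * q := by
    intro s _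
    rw [prod_range_succ']
    simp only [columnWeights, Nat.add_eq_zero_iff, one_ne_zero, and_false, if_false, if_true,
      prod_const, card_range, hq]
    ring
  rw [prod_congr rfl h, prod_mul_distrib, prod_pow_eq_pow_sum, prod_const, card_range]

/-- Since `(k - 1) + (m - k) = m - 1`, dividing by `q (p h)^(m-1)` leaves a polynomial in `q t / (p
h)`. The ratio `t` occurs only in a numerator and may vanish. -/
theorem mul_refined20_sum (w₁ w₂ w₃ : SixWeights) {p q h t : ℂ} (hp : p ≠ 0) (hq : q ≠ 0)
    (hh : h ≠ 0) (m : ℕ) :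
    ∑ k ∈ Icc 1 m, (q * ((Z20Diag w₁ w₂ w₃ m k : ℝ) : ℂ) +
      h * ((Z20Horiz w₁ w₂ w₃ m k : ℝ) : ℂ)) * ((q * t) ^ (k - 1) * (p * h) ^ (m - k)) =
      q * (p * h) ^ (m - 1) * refined20 w₁ w₂ w₃ m (h / q) (q * t / (p * h)) := by
  rw [refined20, mul_sum]
  refine sum_congr rfl fun k hk => ?_
  have hk := mem_Icc.1 hk
  rw [show m - 1 = (k - 1) + (m - k) by omega, pow_add, div_pow]
  generalize ((Z20Diag w₁ w₂ w₃ m k : ℝ) : ℂ) = x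
  generalize ((Z20Horiz w₁ w₂ w₃ m k : ℝ) : ℂ) = y
  field_simp

theorem mul_refined6_sum (w : SixWeights) {p q : ℂ} (hp : p ≠ 0) (n : ℕ) :
    ∑ k ∈ Icc 1 n, ((Z6 w n k : ℝ) : ℂ) * (q ^ (k - 1) * p ^ (n - k)) =
      p ^ (n - 1) * refined6 w n (q / p) := by
  rw [refined6, mul_sum]
  refine sum_congr rfl fun k hk => ?_
  have hk := mem_Icc.1 hk
  rw [show n - 1 = (k - 1) + (n - k) by omega, pow_add, div_pow]
  generalize ((Z6 w n k : ℝ) : ℂ) = x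
  field_simp

/-- The relation between refined partition functions for general weights satisfying the
star-triangle relations. -/
theorem refined20_eq {w₁ w₂ w₃ : SixWeights} {w₁' w₃' : CWeights} {p q h t : ℂ}
    (hYB : IsYB w₁.toC w₂.toC w₃.toC) (hYB' : IsYB w₁' w₂.toC w₃')
    (ha₁ : w₁'.a = p * w₁.a) (hb₁ : w₁'.b = q * w₁.b) (hc₁ : w₁'.c = w₁.c)
    (ha₃ : w₃'.a = h * w₃.a) (hb₃ : w₃'.b = t * w₃.b) (hc₃ : w₃'.c = w₃.c)
    (hp : p ≠ 0) (hq : q ≠ 0) (hh : h ≠ 0)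
    {m n : ℕ} (hn : m / 2 + n = m) (hnpos : 1 ≤ n) :
    refined20 w₁ w₂ w₃ m (h / q) (q * t / (p * h)) =
      ((((w₂.a * w₃.a) ^ (∑ s ∈ range m, (s + 1)) *
        w₁.b ^ ((∑ s ∈ range m, (s + 1)) - n * n) : ℝ)) : ℂ) * (h / q) * (q / p) ^ (m / 2) *
        refined6 w₁ n (q / p) := by
  have hcol : ∀ c, IsYB (columnWeights w₁.toC w₁' c) w₂.toC (columnWeights w₃.toC w₃' c) := by
    intro c
    unfold columnWeights
    split_ifs
    · exact hYB'
    · exact hYB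
  have key := sum_triConfigs_local20 hcol m
  rw [sum_localWeight_columnWeights (p := p * h) (s := q * t) (qh := h) (qd := q)
    (by rw [ha₁, ha₃]; ring) (by rw [hb₁, hb₃]; ring) ha₃ hb₁ hc₁ hc₃ (by omega),
    sum_triConfigs_local6 _ hn, prod_diagonals m (q := h) ha₃, prod_outerVertices hn hb₁ hnpos,
    SqConfig.sum_localWeight_columnWeights ha₁ hb₁ hc₁ hnpos] at key
  rw [mul_refined20_sum w₁ w₂ w₃ hp hq hh, mul_refined6_sum w₁ hp] at key
  have hne : q * (p * h) ^ (m - 1) ≠ 0 := mul_ne_zero hq (pow_ne_zero _ (mul_ne_zero hp hh))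
  refine mul_left_cancel₀ hne (key.trans ?_)
  obtain ⟨d, hd⟩ : ∃ d, m / 2 = d := ⟨_, rfl⟩
  obtain ⟨n, rfl⟩ : ∃ k, n = k + 1 := ⟨n - 1, by omega⟩
  -- With `n` now standing for the old `n - 1`, the powers `h ^ m q ^ d p ^ n` on one side and `q (p
  -- h)^(n + d)` on the other leave `(h / q) (q / p) ^ d`.
  have hm1 : m - 1 = n + d := by omega
  have hm2 : h ^ m = h ^ (n + d) * h := by rw [← pow_succ]; congr 1; omega
  rw [hm1, hm2, hd, Nat.add_sub_cancel, Complex.ofReal_mul, Complex.ofReal_pow,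
    Complex.ofReal_pow, Complex.ofReal_mul]
  simp only [SixWeights.toC]
  generalize ((w₂.a : ℂ) * w₃.a) ^ _ = X
  generalize (w₁.b : ℂ) ^ _ = Y
  generalize refined6 w₁ (n + 1) (q / p) = Z
  rw [div_pow, mul_pow p h, pow_add p n d]
  field_simp

/-! ### Specialisation to the trigonometric weights -/

theorem toC_weights₁ (β η lam : ℝ) : (weights₁ β η lam).toC = trigWeights β η lam := by
  simp [weights₁, SixWeights.toC, trigWeights]

theorem toC_weights₂ (β η lam μ : ℝ) :
    (weights₂ β η lam μ).toC = trigWeights β η (((lam : ℂ) + η - μ) / 2) := by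
  simp only [weights₂, SixWeights.toC, trigWeights]
  push_cast
  congr 3 <;> ring_nf

theorem toC_weights₃ (β η lam μ : ℝ) :
    (weights₃ β η lam μ).toC = trigWeights β η (((lam : ℂ) + η + μ) / 2) := by
  simp only [weights₃, SixWeights.toC, trigWeights]
  push_cast
  congr 3 <;> ring_nf

/-- The spectral parameters are `λ`, `(λ + η - μ) / 2` and `(λ + η + μ) / 2`. Adding `ξ` to the
first and third preserves the relation needed for star-triangle and leaves the `c` weights fixed, so
`refined20_eq` applies with the four ratios of sines as `p, q, h, t`. -/
theorem refined20_weights (η lam μ β₁ β₂ β₃ : ℝ)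
    (hη : 0 < η) (hη_lam : η < lam)
    (hμ_lower : η - lam < μ) (hμ_upper : μ < lam - η) (hlam_η : lam + η < Real.pi)
    (ξ : ℂ) (hξ₁ : Complex.sin (ξ + lam + η) ≠ 0) (hξ₂ : Complex.sin (ξ + lam - η) ≠ 0)
    (hξ₃ : Complex.sin (ξ + (lam + 3 * η + μ) / 2) ≠ 0)
    {m n : ℕ} (hn : m / 2 + n = m) (hnpos : 1 ≤ n) :
    refined20 (weights₁ β₁ η lam) (weights₂ β₂ η lam μ) (weights₃ β₃ η lam μ) m
        (gam η lam μ ξ) (tau η lam μ ξ) =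
      (((((weights₂ β₂ η lam μ).a * (weights₃ β₃ η lam μ).a) ^ (∑ s ∈ range m, (s + 1)) *
        (weights₁ β₁ η lam).b ^ ((∑ s ∈ range m, (s + 1)) - n * n) : ℝ)) : ℂ) *
        gam η lam μ ξ * sig η lam ξ ^ (m / 2) *
        refined6 (weights₁ β₁ η lam) n (sig η lam ξ) := by
  have real_sin : ∀ x : ℝ, 0 < x → x < Real.pi → Complex.sin (x : ℂ) ≠ 0 := fun x h0 h1 => by
    rw [← Complex.ofReal_sin]
    exact Complex.ofReal_ne_zero.2 (Real.sin_pos_of_pos_of_lt_pi h0 h1).ne'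
  have n₁ : Complex.sin ((lam : ℂ) + η) ≠ 0 := by
    simpa using real_sin (lam + η) (by linarith) (by linarith)
  have n₂ : Complex.sin ((lam : ℂ) - η) ≠ 0 := by
    simpa using real_sin (lam - η) (by linarith) (by linarith)
  have n₃ : Complex.sin (((lam : ℂ) + 3 * η + μ) / 2) ≠ 0 := by
    simpa using real_sin ((lam + 3 * η + μ) / 2) (by linarith) (by linarith)
  have n₄ : Complex.sin (((lam : ℂ) - η + μ) / 2) ≠ 0 := by
    simpa using real_sin ((lam - η + μ) / 2) (by linarith) (by linarith)
  have hYB : ∀ x : ℂ, IsYB (trigWeights β₁ η (lam + x)) (weights₂ β₂ η lam μ).toC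
      (trigWeights β₃ η (((lam : ℂ) + η + μ) / 2 + x)) := by
    intro x
    have := isYB_trigWeights β₁ β₂ β₃ η (((lam : ℂ) + η - μ) / 2) (((lam : ℂ) + η + μ) / 2 + x)
    rw [toC_weights₂]
    convert this using 2
    ring
  have hYB0 : IsYB (weights₁ β₁ η lam).toC (weights₂ β₂ η lam μ).toC
      (weights₃ β₃ η lam μ).toC := by
    have := hYB 0
    rwa [add_zero, add_zero, ← toC_weights₁, ← toC_weights₃] at this
  have main := refined20_eq hYB0 (hYB ξ)
    (p := Complex.sin (ξ + lam + η) / Complex.sin (lam + η))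
    (q := Complex.sin (ξ + lam - η) / Complex.sin (lam - η))
    (h := Complex.sin (ξ + (lam + 3 * η + μ) / 2) / Complex.sin ((lam + 3 * η + μ) / 2))
    (t := Complex.sin (ξ + (lam - η + μ) / 2) / Complex.sin ((lam - η + μ) / 2))
    (by
      simp only [trigWeights, weights₁]
      push_cast
      rw [show (lam : ℂ) + ξ + η = ξ + lam + η by ring]
      field_simp)
    (by
      simp only [trigWeights, weights₁]
      push_cast
      rw [show (lam : ℂ) + ξ - η = ξ + lam - η by ring]
      field_simp)
    (by simp [trigWeights, weights₁])
    (by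
      simp only [trigWeights, weights₃]
      push_cast
      rw [show ((lam : ℂ) + η + μ) / 2 + ξ + η = ξ + (lam + 3 * η + μ) / 2 by ring]
      rw [mul_left_comm, div_mul_cancel₀ _ n₃])
    (by
      simp only [trigWeights, weights₃]
      push_cast
      rw [show ((lam : ℂ) + η + μ) / 2 + ξ - η = ξ + (lam - η + μ) / 2 by ring]
      rw [mul_left_comm, div_mul_cancel₀ _ n₄])
    (by simp [trigWeights, weights₃])
    (div_ne_zero hξ₁ n₁) (div_ne_zero hξ₂ n₂) (div_ne_zero hξ₃ n₃) hn hnpos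
  have eg : gam η lam μ ξ =
      Complex.sin (ξ + (lam + 3 * η + μ) / 2) / Complex.sin ((lam + 3 * η + μ) / 2) /
        (Complex.sin (ξ + lam - η) / Complex.sin (lam - η)) := by
    rw [gam, div_div_div_eq]
    ring
  have es : sig η lam ξ = Complex.sin (ξ + lam - η) / Complex.sin (lam - η) /
      (Complex.sin (ξ + lam + η) / Complex.sin (lam + η)) := by
    rw [sig, div_div_div_eq]
    ring
  have et : tau η lam μ ξ = Complex.sin (ξ + lam - η) / Complex.sin (lam - η) *
      (Complex.sin (ξ + (lam - η + μ) / 2) / Complex.sin ((lam - η + μ) / 2)) /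
      (Complex.sin (ξ + lam + η) / Complex.sin (lam + η) *
        (Complex.sin (ξ + (lam + 3 * η + μ) / 2) / Complex.sin ((lam + 3 * η + μ) / 2))) := by
    rw [tau, div_mul_div_comm, div_mul_div_comm, div_div_div_eq]
    ring
  rw [eg, es, et]
  exact main

end TwentyVertex

theorem mainTheorem4 (η lam μ β₁ β₂ β₃ : ℝ)
    (hβ₁ : 0 < β₁) (hβ₂ : 0 < β₂) (hβ₃ : 0 < β₃)
    (hη : 0 < η) (hη_lam : η < lam)
    (hμ_lower : η - lam < μ) (hμ_upper : μ < lam - η)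
    (hlam_η : lam + η < Real.pi) (hη_pi : η < Real.pi / 2)
    (ξ : ℂ)
    (hξ₁ : Complex.sin (ξ + lam + η) ≠ 0)
    (hξ₂ : Complex.sin (ξ + lam - η) ≠ 0)
    (hξ₃ : Complex.sin (ξ + (lam + 3 * η + μ) / 2) ≠ 0)
    (n : ℕ) (hn : 1 ≤ n) :
    TwentyVertex.refined20 (TwentyVertex.weights₁ β₁ η lam) (TwentyVertex.weights₂ β₂ η lam μ)
        (TwentyVertex.weights₃ β₃ η lam μ) (2 * n)
        (TwentyVertex.gam η lam μ ξ) (TwentyVertex.tau η lam μ ξ)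
      = ((((TwentyVertex.weights₂ β₂ η lam μ).a * (TwentyVertex.weights₃ β₃ η lam μ).a)
            ^ (n * (2 * n + 1)) * (TwentyVertex.weights₁ β₁ η lam).b ^ (n * (n + 1)) : ℝ) : ℂ)
        * TwentyVertex.gam η lam μ ξ * TwentyVertex.sig η lam ξ ^ n
        * TwentyVertex.refined6 (TwentyVertex.weights₁ β₁ η lam) n (TwentyVertex.sig η lam ξ)
    ∧
    TwentyVertex.refined20 (TwentyVertex.weights₁ β₁ η lam) (TwentyVertex.weights₂ β₂ η lam μ)
        (TwentyVertex.weights₃ β₃ η lam μ) (2 * n - 1)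
        (TwentyVertex.gam η lam μ ξ) (TwentyVertex.tau η lam μ ξ)
      = ((((TwentyVertex.weights₂ β₂ η lam μ).a * (TwentyVertex.weights₃ β₃ η lam μ).a)
            ^ (n * (2 * n - 1)) * (TwentyVertex.weights₁ β₁ η lam).b ^ (n * (n - 1)) : ℝ) : ℂ)
        * TwentyVertex.gam η lam μ ξ * TwentyVertex.sig η lam ξ ^ (n - 1)
        * TwentyVertex.refined6 (TwentyVertex.weights₁ β₁ η lam) n (TwentyVertex.sig η lam ξ) := by
  -- The triangular numbers giving the exponents are compared after doubling, which avoids division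
  -- in `ℕ`.
  have hdiv : ∀ a b c : ℕ, a * 2 = c → b * 2 = c → a = b := fun a b c h1 h2 => by omega
  constructor
  · have main := TwentyVertex.refined20_weights η lam μ β₁ β₂ β₃ hη hη_lam hμ_lower hμ_upper
      hlam_η ξ hξ₁ hξ₂ hξ₃ (m := 2 * n) (n := n) (by omega) hn
    have e1 : ∑ s ∈ Finset.range (2 * n), (s + 1) = n * (2 * n + 1) :=
      hdiv _ _ _ (TwentyVertex.sum_range_succ_mul_two _) (by ring)
    have e2 : n * (2 * n + 1) - n * n = n * (n + 1) := by
      rw [← Nat.mul_sub]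
      congr 1
      omega
    rwa [e1, e2, Nat.mul_div_cancel_left n two_pos] at main
  · have main := TwentyVertex.refined20_weights η lam μ β₁ β₂ β₃ hη hη_lam hμ_lower hμ_upper
      hlam_η ξ hξ₁ hξ₂ hξ₃ (m := 2 * n - 1) (n := n) (by omega) hn
    have e1 : ∑ s ∈ Finset.range (2 * n - 1), (s + 1) = n * (2 * n - 1) := by
      refine hdiv _ _ _ (TwentyVertex.sum_range_succ_mul_two _) ?_
      rw [Nat.sub_add_cancel (by omega)]
      ring
    have e2 : n * (2 * n - 1) - n * n = n * (n - 1) := by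
      rw [← Nat.mul_sub]
      congr 1
      omega
    rwa [e1, e2, show (2 * n - 1) / 2 = n - 1 by omega] at main
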